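/- Let $n,d\ge 0$ be integers, let $\xi_1,\dots,\xi_n$ be random vectors in $\mathbb{R}^d$ defined on a common probability space, put $S_k=\xi_1+\dots+\xi_k$ for $1\le k\le n$, and let $\mathrm{Conv}(S_1,\dots,S_n)$ be the convex hull of these points. Define the numbers $B(n,k)$ by $$(t+1)(t+3)\cdots(t+2n-1)=\sum_{k=0}^{n}B(n,k)\,t^k,\qquad B(n,k)=0\ \text{ for } k\notin\{0,\dots,n\}.$$ (a) Suppose that $(\xi_1,\dots,\xi_n)$ is symmetrically exchangeable, that is, $(\xi_1,\dots,\xi_n)\stackrel{d}{=}(\varepsilon_1\xi_{\sigma(1)},\dots,\varepsilon_n\xi_{\sigma(n)})$ for every permutation $\sigma$ of $\{1,\dots,n\}$ and all $\varepsilon_1,\dots,\varepsilon_n\in\{-1,1\}$. Suppose also that $n\ge d$ and that for all indices $1\le i_1<\dots<i_d\le n$ the vectors $S_{i_1},\dots,S_{i_d}$ are linearly independent almost surely. Then $$\mathbb{P}\bigl[0\in\mathrm{Conv}(S_1,\dots,S_n)\bigr]=\frac{2}{2^n\,n!}\bigl(B(n,d+1)+B(n,d+3)+\cdots\bigr).$$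 In particular, this probability depends only on $n$ and $d$, and not on the distribution of $(\xi_1,\dots,\xi_n)$. (b) Suppose that $n\ge1$, that $\xi_1,\dots,\xi_n$ are independent and identically distributed with $\xi_1\stackrel{d}{=}-\xi_1$, and that $\mathbb{P}[\xi_1\in H]=0$ for every affine hyperplane $H\subset\mathbb{R}^d$. Then $$\mathbb{P}\bigl[0\notin\mathrm{Conv}(S_1,\dots,S_n)\bigr]=\frac{2}{2^n\,n!}\sum_{k=1}^{\lceil d/2\rceil}B(n,d-2k+1).$$ -/

import Mathlib

open MeasureTheory ProbabilityTheory

namespace RandomWalkHull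

/-- The ambient space `ℝ^d` with its Euclidean structure. -/
abbrev E (d : ℕ) : Type := EuclideanSpace ℝ (Fin d)

/-- The partial sums of `ξ 0, …, ξ (n - 1)`. Indices start at `0`, so that `partialSum ξ k` is
`S_{k+1} = ξ_1 + ⋯ + ξ_{k+1}` in one-based notation; as `k` runs through `Fin n`, these are exactly
`S_1, …, S_n`. -/
noncomputable def partialSum {Ω : Type*} {d n : ℕ} (ξ : Fin n → Ω → E d) (k : Fin n) (ω : Ω) :
    E d :=
  ∑ i ∈ Finset.Iic k, ξ i ω

/-- The convex hull of the values `S_1(ω), …, S_n(ω)`. -/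
noncomputable def hull {Ω : Type*} {d n : ℕ} (ξ : Fin n → Ω → E d) (ω : Ω) : Set (E d) :=
  convexHull ℝ (Set.range fun k : Fin n => partialSum ξ k ω)

/-- The joint law of the tuple is invariant under all permutations of the entries and all
changes of their signs. -/
def SymmetricallyExchangeable {Ω : Type*} [MeasurableSpace Ω] {d n : ℕ} (μ : Measure Ω)
    (ξ : Fin n → Ω → E d) : Prop :=
  ∀ (σ : Equiv.Perm (Fin n)) (ε : Fin n → ℝ), (∀ i, ε i = 1 ∨ ε i = -1) →
    IdentDistrib (fun ω i => ξ i ω) (fun ω i => ε i • ξ (σ i) ω) μ μ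

/-- Any `d` of the partial sums (with distinct indices) are linearly independent a.s. -/
def PartialSumsInGeneralPosition {Ω : Type*} [MeasurableSpace Ω] {d n : ℕ} (μ : Measure Ω)
    (ξ : Fin n → Ω → E d) : Prop :=
  ∀ k : Fin d → Fin n, StrictMono k →
    ∀ᵐ ω ∂μ, LinearIndependent ℝ fun j => partialSum ξ (k j) ω

/-- Affine hyperplanes of `ℝ^d`. -/
def IsAffineHyperplane {d : ℕ} (H : Set (E d)) : Prop :=
  ∃ a : E d, a ≠ 0 ∧ ∃ c : ℝ, H = {x | inner ℝ a x = c}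

/-- `B n k` is the coefficient of `t ^ k` in `(t + 1) (t + 3) ⋯ (t + 2 n - 1)`; it is `0` for
`k > n`. -/
noncomputable def B (n k : ℕ) : ℕ :=
  (∏ i ∈ Finset.range n, (Polynomial.X + Polynomial.C (2 * i + 1)) : Polynomial ℕ).coeff k

end RandomWalkHull

/-! The law of the increments is invariant under all `2 ^ n * n!` signed permutations, so the
absorption probability is the expected proportion of signed permutations `g` for which the walk with
increments `act g x` has `0` in its hull. By `ncard_zero_mem_convexHull` the number of such `g` is
the same for every `x` in general position, so nothing random remains.

Abel summation turns a convex combination of partial sums into a combination of increments with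
nonnegative, nonincreasing coefficients. General position makes these inequalities strict when the
combination vanishes. Hence `g` is counted exactly when `relations x`, of codimension `d`, meets the
open type `B` Weyl chamber of `g`.

The number `R(n, d)` of chambers met satisfies `R(n+1, d) = R(n, d-1) + (2n+1) R(n, d)` for `1 ≤ d ≤
n` (`Generic.regionCount_succ`). Indeed, the walls involving the first coordinate are `2n+1` graphs
over the other coordinates, and deletion-restriction adds them one by one. Forgetting the first
coordinate passes to the vectors modulo `x 0`; restricting to a graph adds `0` or `±x 0` to one
other vector. Both operations preserve genericity, and the coefficients `B` obey the same recursion.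

For (b), a Fubini argument gives general position, and the complementary sum appears because the
even and the odd coefficients each sum to half of `2 ^ n * n!`. -/

namespace RandomWalkHull

/-! ### Regions of a hyperplane arrangement inside a subspace -/

section Arrangement

variable {W ι : Type*} [AddCommGroup W] [Module ℝ W]

/-- The points at which none of the functionals `l e`, `e ∈ F`, vanishes. -/
def regular (l : ι → W →ₗ[ℝ] ℝ) (F : Set ι) : Set W := {w | ∀ e ∈ F, l e w ≠ 0}

/-- The functionals of the family which are positive at `w`. -/
def positivePart (l : ι → W →ₗ[ℝ] ℝ) (F : Set ι) (w : W) : Set ι := {e ∈ F | 0 < l e w}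

/-- The number of regions into which the hyperplanes `l e = 0`, `e ∈ F`, dissect `U`. -/
noncomputable def regionCount (l : ι → W →ₗ[ℝ] ℝ) (F : Set ι) (U : Submodule ℝ W) : ℕ :=
  (positivePart l F '' (U ∩ regular l F)).ncard

theorem positivePart_eq_iff {l : ι → W →ₗ[ℝ] ℝ} {F : Set ι} {w w' : W} :
    positivePart l F w = positivePart l F w' ↔ ∀ e ∈ F, (0 < l e w ↔ 0 < l e w') := by
  simp only [positivePart, Set.ext_iff, Set.mem_ofPred_eq]
  exact forall_congr' fun e => by tauto

/-- Both images are quotients of `S` by the same equivalence relation. -/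
theorem ncard_image_eq_ncard_image {X P Q : Type*} {f : X → P} {h : X → Q} {S : Set X}
    (H : ∀ x ∈ S, ∀ y ∈ S, (f x = f y ↔ h x = h y)) : (f '' S).ncard = (h '' S).ncard := by
  classical
  have hex : ∀ p ∈ f '' S, ∃ x ∈ S, f x = p := fun p hp => hp
  choose g hgS hg using hex
  refine Set.ncard_congr (fun p hp => h (g p hp)) ?_ ?_ ?_
  · intro p hp
    exact ⟨g p hp, hgS p hp, rfl⟩
  · intro p q hp hq hpq
    rw [← hg p hp, ← hg q hq]
    exact (H _ (hgS p hp) _ (hgS q hq)).2 hpq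
  · rintro _ ⟨x, hx, rfl⟩
    have hm := Set.mem_image_of_mem f hx
    exact ⟨f x, hm, (H _ (hgS _ hm) _ hx).1 (hg _ hm)⟩

/-- Two arrangements have equally many regions when a map between them matches the regular points
and the relation of lying in the same region. -/
theorem regionCount_congr {W' ι' : Type*} [AddCommGroup W'] [Module ℝ W']
    {l : ι → W →ₗ[ℝ] ℝ} {F : Set ι} {U : Submodule ℝ W}
    {l' : ι' → W' →ₗ[ℝ] ℝ} {F' : Set ι'} {U' : Submodule ℝ W'} (φ : W → W')
    (hφ : φ '' (U ∩ regular l F) = (U' : Set W') ∩ regular l' F')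
    (H : ∀ w ∈ (U ∩ regular l F : Set W), ∀ w' ∈ (U ∩ regular l F : Set W),
      ((∀ e ∈ F, (0 < l e w ↔ 0 < l e w')) ↔ ∀ e ∈ F', (0 < l' e (φ w) ↔ 0 < l' e (φ w')))) :
    regionCount l F U = regionCount l' F' U' := by
  unfold regionCount
  rw [← hφ, Set.image_image]
  refine ncard_image_eq_ncard_image fun w hw w' hw' => ?_
  rw [positivePart_eq_iff, positivePart_eq_iff]
  exact H w hw w' hw'

theorem exists_pos_perturbation {l : ι → W →ₗ[ℝ] ℝ} {F : Set ι} (hF : F.Finite) {w : W}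
    (hw : w ∈ regular l F) (v : W) :
    ∃ η : ℝ, 0 < η ∧ ∀ t : ℝ, |t| ≤ η → w + t • v ∈ regular l F ∧
      positivePart l F (w + t • v) = positivePart l F w := by
  have key : ∀ e ∈ F, ∀ᶠ t : ℝ in nhds 0, l e (w + t • v) ≠ 0 ∧
      (0 < l e (w + t • v) ↔ 0 < l e w) := by
    intro e he
    have hc : Continuous fun t : ℝ => l e (w + t • v) := by
      simp only [map_add, map_smul, smul_eq_mul]
      fun_prop
    have h0 : l e (w + (0 : ℝ) • v) = l e w := by simp
    rcases lt_or_gt_of_ne (hw e he) with h | h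
    · have := hc.continuousAt.eventually_lt (continuousAt_const (y := (0 : ℝ))) (x₀ := 0)
        (by rwa [h0])
      filter_upwards [this] with t ht
      exact ⟨ht.ne, by constructor <;> intro <;> linarith⟩
    · have := (continuousAt_const (y := (0 : ℝ))).eventually_lt hc.continuousAt (x₀ := 0)
        (by rwa [h0])
      filter_upwards [this] with t ht
      exact ⟨ht.ne', by constructor <;> intro <;> linarith⟩
  have key' := (hF.eventually_all).2 key
  obtain ⟨η, hη, hball⟩ := Metric.eventually_nhds_iff.1 key'
  refine ⟨η / 2, by positivity, fun t ht => ?_⟩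
  have := hball (y := t) (by rw [Real.dist_eq, sub_zero]; linarith)
  exact ⟨fun e he => (this e he).1, positivePart_eq_iff.2 fun e he => (this e he).2⟩

theorem regular_insert {l : ι → W →ₗ[ℝ] ℝ} {F : Set ι} {e : ι} :
    regular l (insert e F) = {w | l e w ≠ 0} ∩ regular l F := by
  ext w
  simp [regular]

/-- Deletion and restriction for the number of regions. -/
theorem regionCount_insert {l : ι → W →ₗ[ℝ] ℝ} {F : Set ι} (hF : F.Finite) {e : ι} (he : e ∉ F)
    {U : Submodule ℝ W} (hU : ∃ v ∈ U, l e v ≠ 0) :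
    regionCount l (insert e F) U =
      regionCount l F U + regionCount l F (U ⊓ LinearMap.ker (l e)) := by
  classical
  obtain ⟨v₀, hv₀U, hv₀⟩ := hU
  obtain ⟨v, hvU, hv⟩ : ∃ v ∈ U, l e v = 1 :=
    ⟨(l e v₀)⁻¹ • v₀, U.smul_mem _ hv₀U, by simp [hv₀]⟩
  -- `A` and `C` are the regions of `F` reaching the positive and the negative side of `e`. The
  -- three counts are `|A| + |C|`, `|A ∪ C|` and `|A ∩ C|`.
  set A : Set (Set ι) := positivePart l F '' (U ∩ regular l F ∩ {w | 0 < l e w}) with hA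
  set C : Set (Set ι) := positivePart l F '' (U ∩ regular l F ∩ {w | l e w < 0}) with hC
  have hfin : ∀ S : Set W, (positivePart l F '' S).Finite := fun S =>
    (hF.finite_subsets).subset (by rintro _ ⟨w, _, rfl⟩; exact fun i hi => hi.1)
  have hunion : positivePart l F '' (U ∩ regular l F) = A ∪ C := by
    apply Set.Subset.antisymm
    · rintro _ ⟨w, ⟨hwU, hw⟩, rfl⟩
      rcases lt_trichotomy (l e w) 0 with h | h | h
      · exact Or.inr ⟨w, ⟨⟨hwU, hw⟩, h⟩, rfl⟩
      · obtain ⟨η, hη, hp⟩ := exists_pos_perturbation hF hw v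
        have := hp η (abs_of_pos hη).le
        exact Or.inl ⟨w + η • v, ⟨⟨U.add_mem hwU (U.smul_mem _ hvU), this.1⟩,
          by simp [h, hv, hη]⟩, this.2⟩
      · exact Or.inl ⟨w, ⟨⟨hwU, hw⟩, h⟩, rfl⟩
    · rintro _ (⟨w, hw, rfl⟩ | ⟨w, hw, rfl⟩) <;> exact ⟨w, hw.1, rfl⟩
  have hinter : positivePart l F '' ((U ⊓ LinearMap.ker (l e) : Submodule ℝ W) ∩ regular l F)
      = A ∩ C := by
    apply Set.Subset.antisymm
    · rintro _ ⟨w, ⟨⟨hwU, hwe⟩, hw⟩, rfl⟩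
      have hwe : l e w = 0 := hwe
      obtain ⟨η, hη, hp⟩ := exists_pos_perturbation hF hw v
      have h1 := hp η (abs_of_pos hη).le
      have h2 := hp (-η) (by rw [abs_neg, abs_of_pos hη])
      exact ⟨⟨w + η • v, ⟨⟨U.add_mem hwU (U.smul_mem _ hvU), h1.1⟩, by simp [hwe, hv, hη]⟩, h1.2⟩,
        ⟨w + (-η) • v, ⟨⟨U.add_mem hwU (U.smul_mem _ hvU), h2.1⟩, by simp [hwe, hv, hη]⟩, h2.2⟩⟩
    · rintro p ⟨⟨a, ⟨⟨haU, ha⟩, hae⟩, rfl⟩, ⟨c, ⟨⟨hcU, hc⟩, hce⟩, hpc⟩⟩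
      have hae : 0 < l e a := hae
      have hce : l e c < 0 := hce
      rw [positivePart_eq_iff] at hpc
      -- The segment from `a` to `c` stays in their common region and crosses the wall of `e`; up to
      -- scale, this is the crossing point.
      have hval : ∀ i, l i ((- l e c) • a + l e a • c) = (- l e c) * l i a + l e a * l i c := by
        intro i; simp
      have hpos : ∀ i ∈ F, 0 < l i a → 0 < l i ((- l e c) • a + l e a • c) := by
        intro i hi h
        rw [hval]
        have := (hpc i hi).2 h
        have h1 := mul_pos (neg_pos.2 hce) h
        have h2 := mul_pos hae this
        linarith
      have hneg : ∀ i ∈ F, l i a < 0 → l i ((- l e c) • a + l e a • c) < 0 := by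
        intro i hi h
        rw [hval]
        have : l i c < 0 :=
          lt_of_le_of_ne (not_lt.1 fun h' => absurd ((hpc i hi).1 h') (not_lt.2 h.le)) (hc i hi)
        have h1 := mul_neg_of_pos_of_neg (neg_pos.2 hce) h
        have h2 := mul_neg_of_pos_of_neg hae this
        linarith
      refine ⟨(- l e c) • a + l e a • c,
        ⟨⟨U.add_mem (U.smul_mem _ haU) (U.smul_mem _ hcU), ?_⟩, ?_⟩, ?_⟩
      · change l e _ = 0
        rw [hval]; ring
      · intro i hi
        rcases lt_or_gt_of_ne (ha i hi) with h | h
        · exact (hneg i hi h).ne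
        · exact (hpos i hi h).ne'
      · refine positivePart_eq_iff.2 fun i hi => ⟨fun h => ?_, hpos i hi⟩
        by_contra h'
        have := hneg i hi (lt_of_le_of_ne (not_lt.1 h') (ha i hi))
        linarith
  have hsplit : positivePart l (insert e F) '' (U ∩ regular l (insert e F)) =
      (insert e) '' A ∪ C := by
    have hP : ∀ w, 0 < l e w → positivePart l (insert e F) w = insert e (positivePart l F w) := by
      intro w hw
      ext i
      simp only [positivePart, Set.mem_ofPred_eq, Set.mem_insert_iff]
      constructor
      · rintro ⟨rfl | h, h'⟩
        · exact Or.inl rfl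
        · exact Or.inr ⟨h, h'⟩
      · rintro (rfl | ⟨h, h'⟩)
        · exact ⟨Or.inl rfl, hw⟩
        · exact ⟨Or.inr h, h'⟩
    have hN : ∀ w, l e w < 0 → positivePart l (insert e F) w = positivePart l F w := by
      intro w hw
      ext i
      simp only [positivePart, Set.mem_ofPred_eq, Set.mem_insert_iff]
      constructor
      · rintro ⟨rfl | h, h'⟩
        · linarith
        · exact ⟨h, h'⟩
      · rintro ⟨h, h'⟩
        exact ⟨Or.inr h, h'⟩
    rw [regular_insert]
    apply Set.Subset.antisymm
    · rintro _ ⟨w, ⟨hwU, hwe, hw⟩, rfl⟩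
      rcases lt_or_gt_of_ne hwe with h | h
      · exact Or.inr ⟨w, ⟨⟨hwU, hw⟩, h⟩, (hN w h).symm⟩
      · exact Or.inl ⟨_, ⟨w, ⟨⟨hwU, hw⟩, h⟩, rfl⟩, (hP w h).symm⟩
    · rintro _ (⟨_, ⟨w, ⟨⟨hwU, hw⟩, h⟩, rfl⟩, rfl⟩ | ⟨w, ⟨⟨hwU, hw⟩, h⟩, rfl⟩)
      · exact ⟨w, ⟨hwU, ne_of_gt h, hw⟩, hP w h⟩
      · exact ⟨w, ⟨hwU, ne_of_lt h, hw⟩, hN w h⟩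
  have hnotmem : ∀ w, e ∉ positivePart l F w := fun w h => he h.1
  have hinj : Set.InjOn (insert e) A := by
    rintro _ ⟨w, _, rfl⟩ _ ⟨w', _, rfl⟩ h
    have := congrArg (fun s : Set ι => s \ {e}) h
    simpa [Set.insert_sdiff_of_mem, Set.sdiff_singleton_eq_self, hnotmem] using this
  have hdisj : Disjoint ((insert e) '' A) C := by
    rw [Set.disjoint_left]
    rintro _ ⟨s, _, rfl⟩ ⟨w, _, h⟩
    exact hnotmem w (h ▸ Set.mem_insert e s)
  have hAf : A.Finite := hfin _
  have hCf : C.Finite := hfin _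
  unfold regionCount
  rw [hsplit, hunion, hinter, Set.ncard_union_eq hdisj (hAf.image _) hCf,
    hinj.ncard_image, Set.ncard_union_add_ncard_inter A C hAf hCf]

end Arrangement

section Arrangement

variable {W ι κ : Type*} [AddCommGroup W] [Module ℝ W]

theorem regular_subset_of_smul {l : ι → W →ₗ[ℝ] ℝ} {F : Set ι} {l' : κ → W →ₗ[ℝ] ℝ} {F' : Set κ}
    (h : ∀ e ∈ F, ∃ e' ∈ F', ∃ c : ℝ, c ≠ 0 ∧ l e = c • l' e') :
    regular l' F' ⊆ regular l F := by
  intro w hw e he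
  obtain ⟨e', he', c, hc, hl⟩ := h e he
  rw [hl]
  exact mul_ne_zero hc (hw e' he')

theorem pos_iff_pos_of_smul {l : ι → W →ₗ[ℝ] ℝ} {F : Set ι} {l' : κ → W →ₗ[ℝ] ℝ} {F' : Set κ}
    (h : ∀ e ∈ F, ∃ e' ∈ F', ∃ c : ℝ, c ≠ 0 ∧ l e = c • l' e') {w w' : W}
    (hw : w ∈ regular l' F') (hw' : w' ∈ regular l' F')
    (H : ∀ e ∈ F', (0 < l' e w ↔ 0 < l' e w')) : ∀ e ∈ F, (0 < l e w ↔ 0 < l e w') := by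
  intro e he
  obtain ⟨e', he', c, hc, hl⟩ := h e he
  have hneg : ∀ {a : ℝ}, a ≠ 0 → (a < 0 ↔ ¬ 0 < a) := fun ha =>
    ⟨fun h => not_lt.2 h.le, fun h => lt_of_le_of_ne (not_lt.1 h) ha⟩
  simp only [hl, LinearMap.smul_apply, smul_eq_mul]
  rcases lt_or_gt_of_ne hc with hc | hc
  · rw [← neg_mul_neg c, ← neg_mul_neg c, mul_pos_iff_of_pos_left (neg_pos.2 hc),
      mul_pos_iff_of_pos_left (neg_pos.2 hc), neg_pos, neg_pos, hneg (hw e' he'),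
      hneg (hw' e' he'), H e' he']
  · rw [mul_pos_iff_of_pos_left hc, mul_pos_iff_of_pos_left hc, H e' he']

/-- The regions depend only on the hyperplanes, not on the functionals defining them. -/
theorem regionCount_eq_of_smul {l : ι → W →ₗ[ℝ] ℝ} {F : Set ι} {l' : κ → W →ₗ[ℝ] ℝ} {F' : Set κ}
    (U : Submodule ℝ W) (h : ∀ e ∈ F, ∃ e' ∈ F', ∃ c : ℝ, c ≠ 0 ∧ l e = c • l' e')
    (h' : ∀ e' ∈ F', ∃ e ∈ F, ∃ c : ℝ, c ≠ 0 ∧ l' e' = c • l e) :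
    regionCount l F U = regionCount l' F' U := by
  have hreg : regular l F = regular l' F' :=
    (regular_subset_of_smul h').antisymm (regular_subset_of_smul h)
  refine regionCount_congr id (by rw [Set.image_id, hreg]) ?_
  rintro w ⟨-, hw⟩ w' ⟨-, hw'⟩
  exact ⟨pos_iff_pos_of_smul h' hw hw', pos_iff_pos_of_smul h (hreg ▸ hw) (hreg ▸ hw')⟩

end Arrangement

/-! ### The type `B` arrangement, fibred over its last coordinates -/

/-- Indices of the `2 n + 1` functionals `0`, `β j`, `-β j` on `Fin n → ℝ`. -/
abbrev Letter (n : ℕ) : Type := Option (Fin n × ℤˣ)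

/-- The functional `0`, `β j` or `-β j` with the given index. -/
noncomputable def letter {n : ℕ} : Letter n → (Fin n → ℝ) →ₗ[ℝ] ℝ
  | none => 0
  | some (j, u) => ((u : ℤ) : ℝ) • LinearMap.proj j

@[simp] theorem letter_none {n : ℕ} : letter (none : Letter n) = 0 := rfl

@[simp] theorem letter_some {n : ℕ} (j : Fin n) (u : ℤˣ) (β : Fin n → ℝ) :
    letter (some (j, u)) β = ((u : ℤ) : ℝ) * β j := rfl

/-- The difference of two letters. For distinct letters its kernel is a hyperplane of the
reflection arrangement of type `B`. -/
noncomputable def rootForm {n : ℕ} (p : Letter n × Letter n) : (Fin n → ℝ) →ₗ[ℝ] ℝ :=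
  letter p.1 - letter p.2

/-- Pairs of distinct letters. -/
def rootIndex (n : ℕ) : Set (Letter n × Letter n) := {p | p.1 ≠ p.2}

/-- Forgetting the first coordinate. -/
def tail (n : ℕ) : (Fin (n + 1) → ℝ) →ₗ[ℝ] (Fin n → ℝ) := LinearMap.funLeft ℝ ℝ Fin.succ

@[simp] theorem tail_apply {n : ℕ} (β : Fin (n + 1) → ℝ) (i : Fin n) : tail n β i = β i.succ := rfl

/-- The roots in the last `n` of `n + 1` coordinates, and the differences of the first coordinate
and the letters in the others. -/
noncomputable def extForm {n : ℕ} :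
    (Letter n × Letter n) ⊕ Letter n → (Fin (n + 1) → ℝ) →ₗ[ℝ] ℝ
  | Sum.inl p => rootForm p ∘ₗ tail n
  | Sum.inr a => LinearMap.proj 0 - letter a ∘ₗ tail n

/-- All roots in the last coordinates, and the letters in `J` for the first one. -/
def extIndex {n : ℕ} (J : Set (Letter n)) : Set ((Letter n × Letter n) ⊕ Letter n) :=
  Sum.inl '' rootIndex n ∪ Sum.inr '' J

theorem forall_extIndex {n : ℕ} {J : Set (Letter n)}
    {P : (Letter n × Letter n) ⊕ Letter n → Prop} :
    (∀ e ∈ extIndex J, P e) ↔ (∀ p ∈ rootIndex n, P (Sum.inl p)) ∧ ∀ a ∈ J, P (Sum.inr a) := by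
  simp only [extIndex, Set.mem_union, Set.mem_image]
  constructor
  · intro h
    exact ⟨fun p hp => h _ (Or.inl ⟨p, hp, rfl⟩), fun a ha => h _ (Or.inr ⟨a, ha, rfl⟩)⟩
  · rintro ⟨h1, h2⟩ e (⟨p, hp, rfl⟩ | ⟨a, ha, rfl⟩)
    exacts [h1 p hp, h2 a ha]

theorem extForm_inr_apply {n : ℕ} (a : Letter n) (w : Fin (n + 1) → ℝ) :
    extForm (Sum.inr a) w = w 0 - letter a (tail n w) := rfl

/-- The walls `w 0 = letter a` are inserted one at a time. On one of them every other wall `w 0 =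
letter b` cuts out the root `letter a - letter b`, which is already present, so the restriction is a
root arrangement in the remaining coordinates. -/
theorem regionCount_extForm {n : ℕ} (J : Finset (Letter n)) (U : Submodule ℝ (Fin (n + 1) → ℝ))
    (hU : ∀ a ∈ J, ∃ v ∈ U, extForm (Sum.inr a) v ≠ 0) :
    regionCount extForm (extIndex (J : Set (Letter n))) U =
      regionCount rootForm (rootIndex n) (U.map (tail n)) +
        ∑ a ∈ J, regionCount rootForm (rootIndex n)
          ((U ⊓ LinearMap.ker (extForm (Sum.inr a))).map (tail n)) := by
  classical
  induction J using Finset.induction_on with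
  | empty =>
    rw [Finset.sum_empty, add_zero]
    refine regionCount_congr (tail n) ?_ ?_
    · ext β
      constructor
      · rintro ⟨w, ⟨hwU, hw⟩, rfl⟩
        exact ⟨⟨w, hwU, rfl⟩, (forall_extIndex.1 hw).1⟩
      · rintro ⟨⟨w, hwU, rfl⟩, hβ⟩
        exact ⟨w, ⟨hwU, forall_extIndex.2 ⟨hβ, by simp⟩⟩, rfl⟩
    · intro w _ w' _
      rw [forall_extIndex]
      simp [extForm]
  | insert a J ha ih =>
    have hins : extIndex ((insert a J : Finset (Letter n)) : Set (Letter n)) =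
        insert (Sum.inr a) (extIndex (J : Set (Letter n))) := by
      rw [extIndex, Finset.coe_insert, Set.image_insert_eq, Set.union_insert]
      rfl
    have hnot : (Sum.inr a : (Letter n × Letter n) ⊕ Letter n) ∉ extIndex (J : Set (Letter n)) := by
      simp [extIndex, ha]
    rw [hins, regionCount_insert (Set.toFinite _) hnot (hU a (Finset.mem_insert_self a J)),
      ih fun b hb => hU b (Finset.mem_insert_of_mem hb), Finset.sum_insert ha]
    have hsub : ∀ w, w 0 = letter a (tail n w) → ∀ b,
        extForm (Sum.inr b) w = rootForm (a, b) (tail n w) := by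
      intro w hw b
      rw [extForm_inr_apply, hw]; rfl
    have hker : ∀ w ∈ U ⊓ LinearMap.ker (extForm (Sum.inr a)), w 0 = letter a (tail n w) :=
      fun w hw => sub_eq_zero.1 hw.2
    have hab : ∀ b ∈ J, (a, b) ∈ rootIndex n := fun b hb h => ha ((show a = b from h) ▸ hb)
    have : regionCount extForm (extIndex (J : Set (Letter n)))
        (U ⊓ LinearMap.ker (extForm (Sum.inr a))) = regionCount rootForm (rootIndex n)
          ((U ⊓ LinearMap.ker (extForm (Sum.inr a))).map (tail n)) := by
      refine regionCount_congr (tail n) ?_ ?_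
      · ext β
        constructor
        · rintro ⟨w, ⟨hwU, hw⟩, rfl⟩
          exact ⟨⟨w, hwU, rfl⟩, (forall_extIndex.1 hw).1⟩
        · rintro ⟨⟨w, hwU, rfl⟩, hβ⟩
          refine ⟨w, ⟨hwU, forall_extIndex.2 ⟨hβ, fun b hb => ?_⟩⟩, rfl⟩
          rw [hsub w (hker w hwU)]
          exact hβ _ (hab b hb)
      · rintro w ⟨hw, -⟩ w' ⟨hw', -⟩
        rw [forall_extIndex]
        refine ⟨fun h => h.1, fun h => ⟨h, fun b hb => ?_⟩⟩
        rw [hsub w (hker w hw), hsub w' (hker w' hw')]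
        exact h _ (hab b hb)
    rw [this]
    ring

/-- Up to a nonzero scalar, a root involving the first coordinate is that coordinate minus a letter
in the others. -/
theorem regionCount_rootForm_succ {n : ℕ} (U : Submodule ℝ (Fin (n + 1) → ℝ)) :
    regionCount rootForm (rootIndex (n + 1)) U = regionCount extForm (extIndex Set.univ) U := by
  have inl_mem : ∀ a b : Letter n, a ≠ b →
      (Sum.inl (a, b) : (Letter n × Letter n) ⊕ Letter n) ∈ extIndex (n := n) Set.univ :=
    fun a b h => Or.inl ⟨(a, b), h, rfl⟩
  have inr_mem : ∀ a : Letter n,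
      (Sum.inr a : (Letter n × Letter n) ⊕ Letter n) ∈ extIndex (n := n) Set.univ :=
    fun a => Or.inr ⟨a, trivial, rfl⟩
  let lift : Letter n → Letter (n + 1) := Option.map fun p => (p.1.succ, p.2)
  have lift_apply : ∀ a β, letter (lift a) β = letter a (tail n β) := by
    rintro (_ | ⟨j, u⟩) β <;> simp [lift]
  have lift_inj : Function.Injective lift := Option.map_injective fun p q h => by
    simpa [Prod.ext_iff] using h
  have lift_ne : ∀ a u, lift a ≠ some (0, u) := by
    rintro (_ | ⟨j, v⟩) u <;> simp [lift, Fin.succ_ne_zero]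
  have letter_or : ∀ a : Letter (n + 1), (∃ b, a = lift b) ∨ ∃ u, a = some (0, u) := by
    rintro (_ | ⟨j, u⟩)
    · exact Or.inl ⟨none, rfl⟩
    · refine Fin.cases (Or.inr ⟨u, rfl⟩) (fun i => Or.inl ⟨some (i, u), rfl⟩) j
  have neg : ∀ a : Letter n, ∃ a' : Letter n, letter a' = - letter a := by
    rintro (_ | ⟨j, u⟩)
    · exact ⟨none, by simp⟩
    · exact ⟨some (j, -u), by ext; simp [letter]⟩
  refine regionCount_eq_of_smul U ?_ (forall_extIndex.2 ⟨?_, ?_⟩)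
  · have hmix : ∀ (a : Letter n) (u : ℤˣ), ∃ e' ∈ extIndex (n := n) Set.univ, ∃ c : ℝ, c ≠ 0 ∧
        rootForm (some (0, u), lift a) = c • extForm e' := by
      intro a u
      rcases Int.units_eq_one_or u with rfl | rfl
      · refine ⟨_, inr_mem a, 1, one_ne_zero, LinearMap.ext fun β => ?_⟩
        simp [rootForm, lift_apply, extForm]
      · obtain ⟨a', ha'⟩ := neg a
        refine ⟨_, inr_mem a', -1, by norm_num, LinearMap.ext fun β => ?_⟩
        simp [rootForm, lift_apply, extForm, ha']
        ring
    rintro ⟨a, b⟩ hab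
    have hab : a ≠ b := hab
    rcases letter_or a with ⟨a, rfl⟩ | ⟨u, rfl⟩ <;> rcases letter_or b with ⟨b, rfl⟩ | ⟨v, rfl⟩
    · refine ⟨_, inl_mem a b fun h => hab (h ▸ rfl), 1, one_ne_zero, LinearMap.ext fun β => ?_⟩
      simp [rootForm, lift_apply, extForm]
    · obtain ⟨e', he', c, hc, h⟩ := hmix a v
      refine ⟨e', he', -c, neg_ne_zero.2 hc, ?_⟩
      calc rootForm (lift a, some (0, v)) = -rootForm (some (0, v), lift a) := by simp [rootForm]
        _ = -c • extForm e' := by rw [h]; ext; simp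
    · exact hmix b u
    -- The difference of the two opposite letters in the first coordinate is `±2` times that
    -- coordinate, hence the wall of the letter `0`.
    · refine ⟨_, inr_mem none, (u : ℤ) - (v : ℤ), ?_, LinearMap.ext fun β => ?_⟩
      · have huv : u ≠ v := fun h => hab (h ▸ rfl)
        rcases Int.units_eq_one_or u with rfl | rfl <;> rcases Int.units_eq_one_or v with rfl | rfl <;>
          first | exact absurd rfl huv | norm_num
      · simp [rootForm, extForm]
        ring
  · rintro ⟨a, b⟩ hab
    refine ⟨(lift a, lift b), lift_inj.ne hab, 1, one_ne_zero, LinearMap.ext fun β => ?_⟩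
    simp [rootForm, lift_apply, extForm]
  · rintro a -
    refine ⟨(some (0, 1), lift a), (lift_ne a 1).symm, 1, one_ne_zero, LinearMap.ext fun β => ?_⟩
    simp [rootForm, lift_apply, extForm]

/-! ### Linear relations and genericity -/

section Relations

variable {V : Type*} [AddCommGroup V] [Module ℝ V]

/-- The linear relations between the vectors `x i`. -/
def relations {n : ℕ} (x : Fin n → V) : Submodule ℝ (Fin n → ℝ) :=
  LinearMap.ker (Fintype.linearCombination ℝ x)

theorem mem_relations {n : ℕ} {x : Fin n → V} {β : Fin n → ℝ} :
    β ∈ relations x ↔ ∑ i, β i • x i = 0 := by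
  simp [relations, Fintype.linearCombination_apply]

/-- `d` signed sums of the vectors over disjoint nonempty blocks always span the space. -/
def Generic {n : ℕ} (d : ℕ) (x : Fin n → V) : Prop :=
  ∀ w : Fin d → Fin n → ℝ, (∀ j i, w j i = 0 ∨ w j i = 1 ∨ w j i = -1) → (∀ j, w j ≠ 0) →
    (∀ i j j', w j i ≠ 0 → w j' i ≠ 0 → j = j') →
    Submodule.span ℝ (Set.range fun j => ∑ i, w j i • x i) = ⊤

/-- The vectors `x 1, …, x n`, with `x 0`, `-x 0` or `0` added to one of them. -/
noncomputable def merge {n : ℕ} (a : Letter n) (x : Fin (n + 1) → V) (i : Fin n) : V :=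
  x i.succ + letter a (Pi.single i 1) • x 0

theorem sum_smul_merge {n : ℕ} (a : Letter n) (x : Fin (n + 1) → V) (β : Fin n → ℝ) :
    ∑ i, β i • merge a x i = letter a β • x 0 + ∑ i, β i • x i.succ := by
  simp only [merge, smul_add, Finset.sum_add_distrib, smul_smul]
  rw [← Finset.sum_smul, add_comm]
  congr 2
  rw [LinearMap.pi_apply_eq_sum_univ (letter a) β]
  refine Finset.sum_congr rfl fun i _ => ?_
  rw [smul_eq_mul]
  congr 2
  ext j
  simp [Pi.single_apply, eq_comm]

/-- Blocks of merged vectors are blocks of the original ones: `x 0` joins the block containing the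
index of `a`, if there is one, with sign `letter a (w j)`. Disjointness survives because at most one
block contains that index. -/
theorem Generic.merge {n d : ℕ} {x : Fin (n + 1) → V} (hx : Generic d x) (a : Letter n) :
    Generic d (merge a x) := by
  intro w hw hw0 hdisj
  have hval : ∀ j, letter a (w j) = 0 ∨ letter a (w j) = 1 ∨ letter a (w j) = -1 := by
    intro j
    rcases a with _ | ⟨i, u⟩
    · simp
    · rw [letter_some]
      rcases Int.units_eq_one_or u with rfl | rfl <;> rcases hw j i with h | h | h <;> simp [h]
  have := hx (fun j => Fin.cons (letter a (w j)) (w j)) ?_ ?_ ?_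
  · rw [← this]
    congr 2
    ext j
    rw [sum_smul_merge, Fin.sum_univ_succ]
    simp
  · intro j i
    refine Fin.cases (hval j) (fun i => ?_) i
    simpa using hw j i
  · intro j h
    exact hw0 j (funext fun i => by simpa using congrFun h i.succ)
  · intro i
    refine Fin.cases ?_ (fun i j j' => ?_) i
    · intro j j' h h'
      simp only [Fin.cons_zero] at h h'
      rcases a with _ | ⟨i, u⟩
      · simp at h
      · rw [letter_some] at h h'
        exact hdisj i j j' (right_ne_zero_of_mul h) (right_ne_zero_of_mul h')
    · simpa using hdisj i j j'

/-- Adjoin the singleton block `{0}`: its sum `x 0` dies in the quotient, so the other block sums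
must span it. -/
theorem Generic.quotient {n d : ℕ} {x : Fin (n + 1) → V} (hx : Generic (d + 1) x) :
    Generic d fun i : Fin n => (Submodule.span ℝ {x 0}).mkQ (x i.succ) := by
  intro w hw hw0 hdisj
  have := hx (Fin.cons (Pi.single 0 1) fun j => Fin.cons 0 (w j)) ?_ ?_ ?_
  · have h2 := congrArg (Submodule.map (Submodule.span ℝ {x 0}).mkQ) this
    rw [Submodule.map_top, Submodule.range_mkQ, Submodule.map_span] at h2
    rw [eq_top_iff, ← h2, Submodule.span_le]
    rintro _ ⟨_, ⟨j, rfl⟩, rfl⟩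
    refine Fin.cases ?_ (fun j => ?_) j
    · have : (Submodule.span ℝ {x 0}).mkQ (x 0) = 0 := by
        rw [Submodule.mkQ_apply, Submodule.Quotient.mk_eq_zero]
        exact Submodule.mem_span_singleton_self _
      simp [this]
    · refine Submodule.subset_span ⟨j, ?_⟩
      simp [Fin.sum_univ_succ]
  · intro j
    refine Fin.cases (fun i => ?_) (fun j i => ?_) j
    · refine Fin.cases ?_ (fun i => ?_) i <;> simp
    · refine Fin.cases ?_ (fun i => ?_) i
      · simp
      · simpa using hw j i
  · intro j
    refine Fin.cases (fun h => ?_) (fun j h => hw0 j (funext fun i => ?_)) j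
    · simpa using congrFun h 0
    · simpa using congrFun h i.succ
  · intro i j j'
    refine Fin.cases ?_ (fun i => ?_) i
    · refine Fin.cases ?_ (fun j => ?_) j <;> refine Fin.cases ?_ (fun j' => ?_) j' <;> simp
    · refine Fin.cases ?_ (fun j => ?_) j <;> refine Fin.cases ?_ (fun j' => ?_) j'
      · simp
      · simp
      · simp
      · simpa using hdisj i j j'

theorem Generic.span_eq_top {n d : ℕ} {x : Fin n → V} (hx : Generic d x) (hd : d ≤ n) :
    Submodule.span ℝ (Set.range (x ∘ Fin.castLE hd)) = ⊤ := by
  have := hx (fun j => Pi.single (Fin.castLE hd j) 1) ?_ ?_ ?_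
  · rw [← this]
    congr 2
    ext j
    simp [Pi.single_apply]
  · intro j i
    by_cases h : i = Fin.castLE hd j <;> simp [h]
  · intro j h
    simpa using congrFun h (Fin.castLE hd j)
  · intro i j j' h h'
    by_contra hne
    have h1 : i = Fin.castLE hd j := by by_contra h1; simp [h1] at h
    have h2 : i = Fin.castLE hd j' := by by_contra h1; simp [h1] at h'
    exact hne (Fin.castLE_injective hd (h1.symm.trans h2))

theorem relations_map_tail {n : ℕ} (x : Fin (n + 1) → V) :
    (relations x).map (tail n) =
      relations fun i : Fin n => (Submodule.span ℝ {x 0}).mkQ (x i.succ) := by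
  ext β
  have hq : ∑ i, β i • (Submodule.span ℝ {x 0}).mkQ (x i.succ) =
      (Submodule.span ℝ {x 0}).mkQ (∑ i, β i • x i.succ) := by simp
  rw [mem_relations, hq, Submodule.mkQ_apply, Submodule.Quotient.mk_eq_zero,
    Submodule.mem_span_singleton]
  constructor
  · rintro ⟨w, hw, rfl⟩
    rw [SetLike.mem_coe, mem_relations, Fin.sum_univ_succ] at hw
    exact ⟨-w 0, by rw [neg_smul]; exact neg_eq_of_add_eq_zero_right hw⟩
  · rintro ⟨c, hc⟩
    refine ⟨Fin.cons (-c) β, ?_, by ext; simp⟩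
    rw [SetLike.mem_coe, mem_relations, Fin.sum_univ_succ]
    simp [← hc]

theorem relations_inf_ker_map_tail {n : ℕ} (x : Fin (n + 1) → V) (a : Letter n) :
    (relations x ⊓ LinearMap.ker (extForm (Sum.inr a))).map (tail n) = relations (merge a x) := by
  ext β
  rw [mem_relations, sum_smul_merge]
  constructor
  · rintro ⟨w, ⟨hw, hwa⟩, rfl⟩
    rw [SetLike.mem_coe, mem_relations, Fin.sum_univ_succ] at hw
    have : w 0 = letter a (tail n w) := sub_eq_zero.1 hwa
    rw [← this]
    exact hw
  · intro h
    refine ⟨Fin.cons (letter a β) β, ⟨?_, ?_⟩, by ext; simp⟩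
    · rw [SetLike.mem_coe, mem_relations, Fin.sum_univ_succ]
      simpa using h
    · have : tail n (Fin.cons (letter a β) β : Fin (n + 1) → ℝ) = β := by ext; simp
      change extForm _ _ = 0
      rw [extForm_inr_apply, this]
      simp

end Relations

/-! ### Recursion and parity sums for the coefficients `B` -/

section Coefficients

theorem B_zero_succ (k : ℕ) : B 0 (k + 1) = 0 := by
  simp [B, Polynomial.coeff_one]

theorem B_zero_zero : B 0 0 = 1 := by
  simp [B]

theorem B_succ_succ (n k : ℕ) : B (n + 1) (k + 1) = B n k + (2 * n + 1) * B n (k + 1) := by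
  rw [B, Finset.prod_range_succ, mul_add, Polynomial.coeff_add, Polynomial.coeff_mul_X,
    Polynomial.coeff_mul_C, mul_comm (2 * n + 1)]
  rfl

theorem B_succ_zero (n : ℕ) : B (n + 1) 0 = (2 * n + 1) * B n 0 := by
  rw [B, Finset.prod_range_succ, mul_add, Polynomial.coeff_add, Polynomial.coeff_mul_X_zero,
    Polynomial.coeff_mul_C, mul_comm (2 * n + 1), zero_add]
  rfl

theorem B_eq_zero_of_lt {n k : ℕ} (h : n < k) : B n k = 0 := by
  induction n generalizing k with
  | zero =>
    obtain ⟨k, rfl⟩ := Nat.exists_eq_succ_of_ne_zero h.ne'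
    exact B_zero_succ k
  | succ n ih =>
    obtain ⟨k, rfl⟩ := Nat.exists_eq_succ_of_ne_zero (Nat.ne_zero_of_lt h)
    rw [Nat.succ_eq_add_one, B_succ_succ, ih (by omega), ih (by omega)]
    simp

/-- The sum `B(n, k) + B(n, k + 2) + ⋯`. -/
noncomputable def altSum (n k : ℕ) : ℕ := ∑ j ∈ Finset.range (n + 1), B n (k + 2 * j)

theorem altSum_eq {n k M : ℕ} (hM : n < k + 2 * M) :
    altSum n k = ∑ j ∈ Finset.range M, B n (k + 2 * j) := by
  have key : ∀ M, n < k + 2 * M → ∀ M', M ≤ M' → ∑ j ∈ Finset.range M', B n (k + 2 * j) =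
      ∑ j ∈ Finset.range M, B n (k + 2 * j) := by
    intro M hM M' hMM'
    refine (Finset.sum_subset (Finset.range_mono hMM') fun j _ hj => B_eq_zero_of_lt ?_).symm
    rw [Finset.mem_range] at hj
    omega
  rw [altSum]
  rcases le_total M (n + 1) with h | h
  · exact key M hM _ h
  · exact (key (n + 1) (by omega) _ h).symm

theorem altSum_eq_zero {n k : ℕ} (h : n < k) : altSum n k = 0 := by
  rw [altSum_eq (M := 0) (by omega)]
  simp

theorem altSum_succ_succ (n k : ℕ) :
    altSum (n + 1) (k + 1) = altSum n k + (2 * n + 1) * altSum n (k + 1) := by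
  rw [altSum_eq (n := n) (k := k) (M := n + 2) (by omega),
    altSum_eq (n := n) (k := k + 1) (M := n + 2) (by omega), altSum, Finset.mul_sum,
    ← Finset.sum_add_distrib]
  refine Finset.sum_congr rfl fun j _ => ?_
  rw [show k + 1 + 2 * j = k + 2 * j + 1 by ring, B_succ_succ]

theorem altSum_eq_add (n k : ℕ) : altSum n k = B n k + altSum n (k + 2) := by
  rw [altSum_eq (n := n) (k := k) (M := n + 2) (by omega), Finset.sum_range_succ', altSum, add_comm]
  congr 1
  exact Finset.sum_congr rfl fun j _ => by congr 1; ring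

/-- The factor `t + 1` makes the polynomial vanish at `-1`, so its even and odd coefficients have
equal sums. -/
theorem altSum_one_eq_altSum_zero (n : ℕ) : altSum (n + 1) 1 = altSum (n + 1) 0 := by
  have h1 : altSum (n + 1) 1 = altSum n 0 + (2 * n + 1) * altSum n 1 := altSum_succ_succ n 0
  have h0 : altSum (n + 1) 0 = altSum n 1 + (2 * n + 1) * altSum n 0 := by
    rw [altSum_eq_add, B_succ_zero, altSum_succ_succ n 1, altSum_eq_add n 0]
    ring
  cases n with
  | zero =>
    rw [h1, h0]
    simp [altSum, B_zero_zero, B_zero_succ]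
  | succ n => rw [h1, h0, altSum_one_eq_altSum_zero n]

/-- Both sides are the value `2 · 4 ⋯ (2n + 2)` of the polynomial at `1`. -/
theorem two_mul_altSum_one (n : ℕ) : 2 * altSum (n + 1) 1 = 2 ^ (n + 1) * (n + 1).factorial := by
  induction n with
  | zero => simp [altSum, Finset.sum_range_succ, B_succ_succ, B_zero_zero, B_zero_succ]
  | succ n ih =>
    rw [altSum_succ_succ, zero_add, ← altSum_one_eq_altSum_zero, Nat.factorial_succ (n + 1), pow_succ,
      show 2 * (altSum (n + 1) 1 + (2 * (n + 1) + 1) * altSum (n + 1) 1) =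
      (2 * (n + 2)) * (2 * altSum (n + 1) 1) by ring, ih]
    ring

end Coefficients

/-! ### Chambers met by a generic subspace -/

section Count

theorem Generic.linearIndependent {V : Type*} [AddCommGroup V] [Module ℝ V] {n : ℕ}
    {x : Fin n → V} (hx : Generic n x) (hn : Module.finrank ℝ V = n) : LinearIndependent ℝ x := by
  have := hx.span_eq_top le_rfl
  exact linearIndependent_of_top_le_span_of_card_eq_finrank this.ge (by simp [hn])

theorem relations_eq_bot {V : Type*} [AddCommGroup V] [Module ℝ V] {n : ℕ} {x : Fin n → V}
    (hx : LinearIndependent ℝ x) : relations x = ⊥ := by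
  rw [eq_bot_iff]
  intro β hβ
  rw [mem_relations] at hβ
  exact funext (Fintype.linearIndependent_iff.1 hx β hβ)

theorem card_letter (n : ℕ) : Fintype.card (Letter n) = 2 * n + 1 := by
  simp [Letter, mul_comm]

/-- The space of relations of generic vectors is not contained in the wall of a letter. -/
theorem Generic.exists_relation_extForm_ne_zero {V : Type*} [AddCommGroup V] [Module ℝ V] {n d : ℕ}
    {x : Fin (n + 1) → V} (hx : Generic d x) (hd : d ≤ n) (a : Letter n) :
    ∃ v ∈ relations x, extForm (Sum.inr a) v ≠ 0 := by
  have h := (hx.merge a).span_eq_top hd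
  have htop : Submodule.span ℝ (Set.range (RandomWalkHull.merge a x)) = ⊤ :=
    eq_top_iff.2 (h ▸ Submodule.span_mono (Set.range_comp_subset_range _ _))
  have hmem : -x 0 ∈ Submodule.span ℝ (Set.range (RandomWalkHull.merge a x)) := htop ▸ trivial
  obtain ⟨β, hβ⟩ := (Submodule.mem_span_range_iff_exists_fun ℝ).1 hmem
  rw [sum_smul_merge] at hβ
  -- The first coordinate is chosen to make the functional equal to `1`.
  refine ⟨Fin.cons (1 + letter a β) β, ?_, ?_⟩
  · rw [mem_relations, Fin.sum_univ_succ]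
    simp only [Fin.cons_zero, Fin.cons_succ, add_smul, one_smul, add_assoc, hβ, add_neg_cancel]
  · have : tail n (Fin.cons (1 + letter a β) β : Fin (n + 1) → ℝ) = β := by ext; simp
    rw [extForm_inr_apply, this]
    simp

theorem Generic.regionCount_succ {V : Type*} [AddCommGroup V] [Module ℝ V] {n d : ℕ}
    {x : Fin (n + 1) → V} (hx : Generic d x) (hd : d ≤ n) :
    regionCount rootForm (rootIndex (n + 1)) (relations x) =
      regionCount rootForm (rootIndex n)
        (relations fun i : Fin n => (Submodule.span ℝ {x 0}).mkQ (x i.succ)) +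
      ∑ a : Letter n, regionCount rootForm (rootIndex n) (relations (RandomWalkHull.merge a x)) := by
  have := regionCount_extForm Finset.univ (relations x)
    fun a _ => hx.exists_relation_extForm_ne_zero hd a
  rw [regionCount_rootForm_succ, ← Finset.coe_univ, this, relations_map_tail]
  simp only [relations_inf_ker_map_tail]

theorem regionCount_rootForm_zero (U : Submodule ℝ (Fin 0 → ℝ)) :
    regionCount rootForm (rootIndex 0) U = 1 := by
  have hroot : ∀ p : Letter 0 × Letter 0, p ∉ rootIndex 0 := by
    rintro ⟨_ | ⟨j, _⟩, _ | ⟨k, _⟩⟩ h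
    · exact h rfl
    · exact k.elim0
    · exact j.elim0
    · exact j.elim0
  have hemp : rootIndex 0 = ∅ := Set.eq_empty_of_forall_notMem hroot
  have hreg : regular (rootForm (n := 0)) ∅ = Set.univ := by simp [regular]
  have hpos : positivePart (rootForm (n := 0)) ∅ = fun _ => ∅ := by
    funext w; simp [positivePart]
  rw [regionCount, hemp, hreg, Set.inter_univ, hpos,
    Set.Nonempty.image_const ⟨0, U.zero_mem⟩, Set.ncard_singleton]

/-- The vectors form a basis, so the only relation is `0`, and it lies on every wall; at least one
wall exists since `n + 1 > 0`. -/
theorem Generic.regionCount_eq_zero {V : Type*} [AddCommGroup V] [Module ℝ V] {n : ℕ}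
    {x : Fin (n + 1) → V} (hx : Generic (n + 1) x) (hV : Module.finrank ℝ V = n + 1) :
    regionCount rootForm (rootIndex (n + 1)) (relations x) = 0 := by
  rw [relations_eq_bot (hx.linearIndependent hV), regionCount]
  refine (congrArg Set.ncard (Set.image_eq_empty.2 ?_)).trans (Set.ncard_empty _)
  ext w
  simp only [Set.mem_inter_iff, SetLike.mem_coe, Submodule.mem_bot, Set.mem_empty_iff_false,
    iff_false, not_and]
  rintro rfl hw
  exact hw (none, some (0, 1)) (by simp [rootIndex]) (map_zero _)

theorem Generic.finrank_quotient {V : Type*} [AddCommGroup V] [Module ℝ V] {n d : ℕ}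
    {x : Fin (n + 1) → V} (hx : Generic (d + 1) x) (hd : d ≤ n)
    (hV : Module.finrank ℝ V = d + 1) :
    Module.finrank ℝ (V ⧸ Submodule.span ℝ {x 0}) = d := by
  have : FiniteDimensional ℝ V := FiniteDimensional.of_finrank_pos (by omega)
  have hli : LinearIndependent ℝ (x ∘ Fin.castLE (by omega : d + 1 ≤ n + 1)) :=
    linearIndependent_of_top_le_span_of_card_eq_finrank (hx.span_eq_top _).ge (by simp [hV])
  have h0 : x 0 ≠ 0 := hli.ne_zero 0
  have h1 := Submodule.finrank_quotient_add_finrank (Submodule.span ℝ {x 0})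
  rw [finrank_span_singleton h0] at h1
  omega

/-- The number of chambers of the reflection arrangement of type `B` which a generic linear
subspace of codimension `d` meets. -/
theorem Generic.regionCount_eq.{u} (n : ℕ) : ∀ {V : Type u} [AddCommGroup V] [Module ℝ V] {d : ℕ}
    {x : Fin (n + 1) → V}, FiniteDimensional ℝ V → Generic d x → d ≤ n + 1 →
    Module.finrank ℝ V = d →
    regionCount rootForm (rootIndex (n + 1)) (relations x) = 2 * altSum (n + 1) (d + 1) := by
  induction n with
  | zero =>
    intro V _ _ d x _ hx hd hV
    rcases hd.eq_or_lt with rfl | hd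
    · rw [hx.regionCount_eq_zero hV, altSum_eq_zero (by omega)]
    · obtain rfl : d = 0 := by omega
      rw [hx.regionCount_succ le_rfl, regionCount_rootForm_zero]
      simp only [regionCount_rootForm_zero]
      rw [two_mul_altSum_one]
      simp
  | succ n ih =>
    intro V _ _ d x _ hx hd hV
    rcases hd.eq_or_lt with rfl | hd
    · rw [hx.regionCount_eq_zero hV, altSum_eq_zero (by omega)]
    · rw [hx.regionCount_succ (by omega),
        Finset.sum_congr rfl fun a _ => ih inferInstance (hx.merge a) (by omega) hV,
        Finset.sum_const, Finset.card_univ, card_letter, smul_eq_mul]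
      cases d with
      | zero =>
        -- In dimension `0` the quotient cannot drop further, so the recursion yields `altSum (n +
        -- 1) 1` where `altSum (n + 1) 0` is needed. The equality of the parity sums repairs this.
        have hV' : Module.finrank ℝ (V ⧸ Submodule.span ℝ {x 0}) = 0 := by
          have := Submodule.finrank_quotient_le (R := ℝ) (Submodule.span ℝ {x 0})
          omega
        have hq : Generic 0 fun i : Fin (n + 1) => (Submodule.span ℝ {x 0}).mkQ (x i.succ) := by
          have : Subsingleton (V ⧸ Submodule.span ℝ {x 0}) := Module.finrank_zero_iff.1 hV'
          exact fun _ _ _ _ => Subsingleton.elim _ _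
        rw [ih inferInstance hq (by omega) hV', altSum_succ_succ (n + 1) 0, ← altSum_one_eq_altSum_zero]
        ring
      | succ d =>
        rw [ih inferInstance hx.quotient (by omega) (hx.finrank_quotient (by omega) hV),
          altSum_succ_succ (n + 1) (d + 1)]
        ring

end Count

/-! ### From convex combinations to decreasing coefficients -/

section Hull

variable {V : Type*} [AddCommGroup V] [Module ℝ V]

/-- The partial sums of a finite sequence of vectors. -/
def psum {n : ℕ} (x : Fin n → V) (k : Fin n) : V := ∑ i ∈ Finset.Iic k, x i

/-- The signed permutations of `n` coordinates. -/
abbrev SignedPerm (n : ℕ) : Type := Equiv.Perm (Fin n) × (Fin n → ℤˣ)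

/-- Permute the vectors and change their signs. -/
def act {n : ℕ} (g : SignedPerm n) (x : Fin n → V) (i : Fin n) : V :=
  ((g.2 i : ℤ) : ℝ) • x (g.1 i)

theorem zero_mem_convexHull_range_iff {n : ℕ} {s : Fin n → V} :
    (0 : V) ∈ convexHull ℝ (Set.range s) ↔ ∃ c ∈ stdSimplex ℝ (Fin n), ∑ k, c k • s k = 0 := by
  have h : convexHull ℝ (Set.range s) =
      (Fintype.linearCombination ℝ s) '' stdSimplex ℝ (Fin n) := by
    classical
    rw [← convexHull_rangle_single_eq_stdSimplex, LinearMap.image_convexHull, ← Set.range_comp]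
    congr 2
    ext k
    simp [Fintype.linearCombination_apply]
  rw [h]
  rfl

/-- If any `d` of the vectors are independent in dimension `d`, then a convex combination equal to
`0` can be chosen with positive coefficients. -/
theorem exists_pos_relation [FiniteDimensional ℝ V] {n d : ℕ} {s : Fin n → V}
    (hV : Module.finrank ℝ V = d) (hd : d ≤ n)
    (hs : ∀ J : Finset (Fin n), J.card = d → LinearIndepOn ℝ s (J : Set (Fin n)))
    {c : Fin n → ℝ} (hc : c ∈ stdSimplex ℝ (Fin n)) (h0 : ∑ k, c k • s k = 0) :
    ∃ c' : Fin n → ℝ, (∀ k, 0 < c' k) ∧ ∑ k, c' k • s k = 0 := by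
  classical
  set I : Finset (Fin n) := Finset.univ.filter fun k => c k ≠ 0 with hI
  have hcI : ∀ k ∉ I, c k = 0 := fun k hk => by simpa [hI] using hk
  -- A relation supported on fewer than `d` independent vectors would vanish, contradicting total
  -- weight `1`.
  have hcard : d ≤ I.card := by
    by_contra hlt
    obtain ⟨J, hIJ, -, hJ⟩ := Finset.exists_subsuperset_card_eq (Finset.subset_univ I)
      (not_le.1 hlt).le (by simpa using hd)
    have hsum : ∑ k ∈ J, c k • s k = 0 := by
      rw [← h0]
      exact Finset.sum_subset (Finset.subset_univ J) fun k _ hk => by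
        rw [hcI k fun h => hk (hIJ h), zero_smul]
    have hz := linearIndepOn_finset_iff.1 (hs J hJ) c hsum
    have hall : ∀ k, c k = 0 := fun k => by
      by_cases hk : k ∈ J
      · exact hz k hk
      · exact hcI k fun h => hk (hIJ h)
    have := hc.2
    simp [hall] at this
  obtain ⟨J, hJI, hJ⟩ := Finset.exists_subset_card_eq hcard
  have hspan : Submodule.span ℝ (s '' (J : Set (Fin n))) = ⊤ := by
    have := (hs J hJ).linearIndependent.span_eq_top_of_card_eq_finrank' (by simp [hV, hJ])
    rwa [Set.image_eq_range]
  -- The vectors outside the support are expanded in a basis taken from the support. Adding a small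
  -- multiple of the resulting relation gives them positive weight and keeps the others positive.
  have hz : ∑ k ∈ Iᶜ, s k ∈ Submodule.span ℝ (s '' (J : Set (Fin n))) := hspan ▸ trivial
  obtain ⟨b, hb⟩ := (Submodule.mem_span_image_finset_iff_exists_fun' ℝ).1 hz
  set b' : Fin n → ℝ := fun k => if k ∈ J then b k else 0 with hb'
  have hbs : ∑ k, b' k • s k = ∑ k ∈ Iᶜ, s k := by
    rw [← hb]
    simp [hb', ite_smul, Finset.sum_ite_mem]
  have hind : ∑ k, (if k ∈ Iᶜ then (1 : ℝ) else 0) • s k = ∑ k ∈ Iᶜ, s k := by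
    simp only [ite_smul, one_smul, zero_smul, Finset.sum_ite_mem, Finset.univ_inter]
  have hev : ∀ k ∈ I, ∀ᶠ t : ℝ in nhdsWithin 0 (Set.Ioi 0), 0 < c k - t * b' k := by
    intro k hk
    have hcont : Continuous fun t : ℝ => c k - t * b' k := by fun_prop
    have hpos : 0 < c k - 0 * b' k := by
      have : c k ≠ 0 := by simpa [hI] using hk
      simpa using lt_of_le_of_ne (hc.1 k) this.symm
    exact nhdsWithin_le_nhds (hcont.continuousAt.eventually (lt_mem_nhds hpos))
  obtain ⟨t, ht, ht0⟩ := (((Finset.eventually_all I).2 hev).and self_mem_nhdsWithin).exists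
  have ht0 : 0 < t := ht0
  refine ⟨fun k => c k + t * ((if k ∈ Iᶜ then (1 : ℝ) else 0) - b' k), fun k => ?_, ?_⟩
  · by_cases hk : k ∈ I
    · have := ht k hk
      simp only [Finset.mem_compl, hk, not_true_eq_false, if_false]
      linarith
    · have : b' k = 0 := if_neg fun h => hk (hJI h)
      simp [hk, this, hcI k hk, ht0]
  · simp only [add_smul, mul_smul, sub_smul, Finset.sum_add_distrib, ← Finset.smul_sum,
      Finset.sum_sub_distrib, h0, hbs, hind]
    simp

theorem sum_smul_psum {n : ℕ} (c : Fin n → ℝ) (x : Fin n → V) :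
    ∑ k, c k • psum x k = ∑ i, (∑ k ∈ Finset.Ici i, c k) • x i := by
  simp only [psum, Finset.smul_sum, Finset.sum_smul]
  exact Finset.sum_comm' (by simp)

theorem exists_pos_sum_Ici_eq {n : ℕ} {β : Fin n → ℝ} (hβ : ∀ i, 0 < β i) (hβ' : StrictAnti β) :
    ∃ c : Fin n → ℝ, (∀ k, 0 < c k) ∧ ∀ i, ∑ k ∈ Finset.Ici i, c k = β i := by
  -- Extending `β` by `0` lets the last weight be `β` itself and the differences telescope.
  set b : ℕ → ℝ := fun m => if h : m < n then β ⟨m, h⟩ else 0 with hb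
  refine ⟨fun k => b k - b (k + 1), fun k => ?_, fun i => ?_⟩
  · have h1 : b k = β k := by simp [hb]
    change 0 < b k - b (k + 1)
    rw [h1, sub_pos]
    by_cases h : (k : ℕ) + 1 < n
    · simp only [hb, h, dif_pos]
      exact hβ' (Fin.lt_def.2 (Nat.lt_succ_self _))
    · simp only [hb, h, dif_neg, not_false_iff]
      exact hβ k
  · have h1 : ∑ k ∈ Finset.Ici i, (b k - b (k + 1)) =
        ∑ m ∈ Finset.Ico (i : ℕ) n, (b m - b (m + 1)) := by
      rw [← Fin.map_valEmbedding_Ici, Finset.sum_map]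
      rfl
    rw [h1, Finset.sum_Ico_eq_sub _ i.2.le, Finset.sum_range_sub', Finset.sum_range_sub']
    simp [hb]

/-- Tail sums of positive weights are positive and strictly decreasing, and every such sequence
arises this way. The condition `n ≠ 0` excludes the empty hull. -/
theorem zero_mem_convexHull_psum_iff [FiniteDimensional ℝ V] {n d : ℕ} {x : Fin n → V}
    (hV : Module.finrank ℝ V = d) (hd : d ≤ n)
    (hs : ∀ J : Finset (Fin n), J.card = d → LinearIndepOn ℝ (psum x) (J : Set (Fin n))) :
    (0 : V) ∈ convexHull ℝ (Set.range (psum x)) ↔ n ≠ 0 ∧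
      ∃ β : Fin n → ℝ, (∀ i, 0 < β i) ∧ StrictAnti β ∧ ∑ i, β i • x i = 0 := by
  rw [zero_mem_convexHull_range_iff]
  constructor
  · rintro ⟨c, hc, h0⟩
    refine ⟨?_, ?_⟩
    · rintro rfl
      simpa using hc.2
    obtain ⟨c, hc, h0⟩ := exists_pos_relation hV hd hs hc h0
    refine ⟨fun i => ∑ k ∈ Finset.Ici i, c k,
      fun i => Finset.sum_pos (fun k _ => hc k) ⟨i, Finset.mem_Ici.2 le_rfl⟩, fun i j hij => ?_, ?_⟩
    · refine Finset.sum_lt_sum_of_subset (Finset.Ici_subset_Ici.2 hij.le)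
        (Finset.mem_Ici.2 (le_refl i)) (by simpa using hij) (hc i) fun k _ _ => (hc k).le
    · rw [← sum_smul_psum, h0]
  · rintro ⟨hn, β, hβ, hβ', h0⟩
    obtain ⟨c, hc, hcβ⟩ := exists_pos_sum_Ici_eq hβ hβ'
    have hsum : 0 < ∑ k, c k :=
      Finset.sum_pos (fun k _ => hc k) ⟨⟨0, Nat.pos_of_ne_zero hn⟩, Finset.mem_univ _⟩
    refine ⟨fun k => (∑ k, c k)⁻¹ * c k, ⟨fun k => ?_, ?_⟩, ?_⟩
    · exact (mul_pos (inv_pos.2 hsum) (hc k)).le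
    · rw [← Finset.mul_sum, inv_mul_cancel₀ hsum.ne']
    · simp only [mul_smul, ← Finset.smul_sum, sum_smul_psum, hcβ, h0, smul_zero]

end Hull

/-! ### Weyl chambers of type `B` and signed permutations -/

section Chamber

variable {n : ℕ}

/-- `γ` lies in the open Weyl chamber of type `B` given by the signed permutation `g`. -/
def InChamber (g : SignedPerm n) (γ : Fin n → ℝ) : Prop :=
  (∀ i, 0 < act g γ i) ∧ StrictAnti (act g γ)

theorem unit_mul_self (u : ℤˣ) : ((u : ℤ) : ℝ) * ((u : ℤ) : ℝ) = 1 := by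
  rcases Int.units_eq_one_or u with rfl | rfl <;> simp

theorem InChamber.letter_cases {g : SignedPerm n} (a : Letter n) :
    (∀ γ, letter a γ = 0) ∨ (∃ i, ∀ γ, letter a γ = act g γ i) ∨
      ∃ i, ∀ γ, letter a γ = -act g γ i := by
  rcases a with _ | ⟨j, u⟩
  · simp
  · obtain ⟨i, rfl⟩ := g.1.surjective j
    rcases Int.units_eq_one_or u with rfl | rfl <;>
      rcases Int.units_eq_one_or (g.2 i) with h | h
    · exact Or.inr (Or.inl ⟨i, fun γ => by simp [act, h]⟩)
    · exact Or.inr (Or.inr ⟨i, fun γ => by simp [act, h]⟩)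
    · exact Or.inr (Or.inr ⟨i, fun γ => by simp [act, h]⟩)
    · exact Or.inr (Or.inl ⟨i, fun γ => by simp [act, h]⟩)

/-- In a chamber the letters are `0` and the signed entries of a positive decreasing sequence, so
their linear order is fixed. -/
theorem InChamber.letter_lt {g : SignedPerm n} {γ γ' : Fin n → ℝ} (h : InChamber g γ)
    (h' : InChamber g γ') {a b : Letter n} (hab : letter a γ < letter b γ) :
    letter a γ' < letter b γ' := by
  rcases InChamber.letter_cases (g := g) a with ha | ⟨i, ha⟩ | ⟨i, ha⟩ <;>
    rcases InChamber.letter_cases (g := g) b with hb | ⟨k, hb⟩ | ⟨k, hb⟩ <;>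
    rw [ha, hb] at hab ⊢
  · exact hab
  · exact h'.1 k
  · linarith [h.1 k]
  · linarith [h.1 i]
  · exact h'.2.lt_iff_gt.2 (h.2.lt_iff_gt.1 hab)
  · linarith [h.1 k, h.1 i]
  · linarith [h'.1 i]
  · linarith [h'.1 i, h'.1 k]
  · exact neg_lt_neg (h'.2.lt_iff_gt.2 (h.2.lt_iff_gt.1 (neg_lt_neg_iff.1 hab)))

theorem rootForm_pos_iff {p : Letter n × Letter n} {γ : Fin n → ℝ} :
    0 < rootForm p γ ↔ letter p.2 γ < letter p.1 γ := by
  simp [rootForm]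

theorem mem_regular_rootForm_iff {γ : Fin n → ℝ} :
    γ ∈ regular rootForm (rootIndex n) ↔ Function.Injective fun a => letter a γ := by
  constructor
  · intro h a b hab
    by_contra hne
    exact h (a, b) hne (sub_eq_zero.2 hab)
  · intro h p hp h0
    exact hp (h (sub_eq_zero.1 h0))

theorem InChamber.mem_regular {g : SignedPerm n} {γ : Fin n → ℝ} (h : InChamber g γ) :
    γ ∈ regular rootForm (rootIndex n) := by
  have hne : ∀ j, γ j ≠ 0 := by
    intro j hj
    obtain ⟨i, rfl⟩ := g.1.surjective j
    simpa [act, hj] using h.1 i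
  have habs : ∀ i, |γ (g.1 i)| = act g γ i := by
    intro i
    have := h.1 i
    rw [← abs_of_pos this, act, smul_eq_mul, abs_mul]
    rcases Int.units_eq_one_or (g.2 i) with h | h <;> simp [h]
  rw [mem_regular_rootForm_iff]
  have habs_letter : ∀ (j : Fin n) (u : ℤˣ), |letter (some (j, u)) γ| = |γ j| := by
    intro j u
    rcases Int.units_eq_one_or u with h | h <;> simp [h]
  rintro (_ | ⟨j, u⟩) (_ | ⟨k, v⟩) hab
  · rfl
  · have := congrArg abs hab
    simp only [habs_letter] at this
    simp [eq_comm, hne] at this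
  · have := congrArg abs hab
    simp only [habs_letter] at this
    simp [hne] at this
  · have := congrArg abs hab
    simp only [habs_letter] at this
    obtain ⟨i, rfl⟩ := g.1.surjective j
    obtain ⟨l, rfl⟩ := g.1.surjective k
    rw [habs, habs] at this
    obtain rfl := h.2.injective this
    have hu := mul_right_cancel₀ (hne _) (show ((u : ℤ) : ℝ) * _ = ((v : ℤ) : ℝ) * _ from hab)
    rw [Units.ext (Int.cast_injective hu)]

theorem exists_inChamber {γ : Fin n → ℝ} (hγ : γ ∈ regular rootForm (rootIndex n)) :
    ∃ g, InChamber g γ := by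
  rw [mem_regular_rootForm_iff] at hγ
  have hne : ∀ j, γ j ≠ 0 := fun j hj => by
    have := hγ (a₁ := some (j, 1)) (a₂ := none) (by simp [hj])
    simp at this
  have hinj : Function.Injective fun j => |γ j| := by
    intro j k hjk
    rcases abs_eq_abs.1 hjk with h | h
    · have := hγ (a₁ := some (j, 1)) (a₂ := some (k, 1)) (by simp [h])
      simpa using this
    · have := hγ (a₁ := some (j, 1)) (a₂ := some (k, -1)) (by simp [h])
      simp at this
  set σ := Tuple.sort fun j => -|γ j| with hσ
  have hmono : Monotone ((fun j => -|γ j|) ∘ σ) := Tuple.monotone_sort _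
  have hact : act (σ, fun i => if 0 ≤ γ (σ i) then 1 else -1) γ = fun i => |γ (σ i)| := by
    ext i
    simp only [act, smul_eq_mul]
    split_ifs with h
    · simp [abs_of_nonneg h]
    · simp [abs_of_neg (not_le.1 h)]
  refine ⟨(σ, fun i => if 0 ≤ γ (σ i) then 1 else -1), ?_, ?_⟩
  · rw [hact]
    exact fun i => abs_pos.2 (hne _)
  · rw [hact]
    intro i k hik
    refine lt_of_le_of_ne (neg_le_neg_iff.1 (hmono hik.le)) fun h => ?_
    exact hik.ne' (σ.injective (hinj h))

/-- `act g γ` must be the decreasing rearrangement of the distinct numbers `|γ j|`, which determines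
the permutation and then the signs. -/
theorem InChamber.unique {g g' : SignedPerm n} {γ : Fin n → ℝ} (h : InChamber g γ)
    (h' : InChamber g' γ) : g = g' := by
  have habs : ∀ {g : SignedPerm n}, InChamber g γ → ∀ i, |γ (g.1 i)| = act g γ i := by
    intro g h i
    have := h.1 i
    rw [← abs_of_pos this, act, smul_eq_mul, abs_mul]
    rcases Int.units_eq_one_or (g.2 i) with h | h <;> simp [h]
  have hrange : ∀ {g : SignedPerm n}, InChamber g γ →
      Set.range (fun i => -act g γ i) = Set.range fun j => -|γ j| := by
    intro g h
    rw [← g.1.surjective.range_comp fun j => -|γ j|]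
    congr 1
    ext i
    simp [habs h]
  have hstrict : ∀ {g : SignedPerm n}, InChamber g γ → StrictMono fun i => -act g γ i :=
    fun h _ _ hij => neg_lt_neg (h.2 hij)
  have heq : act g γ = act g' γ := by
    have := ((hstrict h).range_inj (hstrict h')).1 ((hrange h).trans (hrange h').symm)
    ext i
    simpa using congrFun this i
  have hinj : Function.Injective fun j => |γ j| := by
    intro j k hjk
    obtain ⟨i, rfl⟩ := g.1.surjective j
    obtain ⟨l, rfl⟩ := g.1.surjective k
    simp only [habs h] at hjk
    rw [h.2.injective hjk]
  have hσ : g.1 = g'.1 := Equiv.ext fun i => hinj (by simp only [habs h, habs h', heq])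
  refine Prod.ext hσ (funext fun i => ?_)
  have hi := congrFun heq i
  have hne : γ (g'.1 i) ≠ 0 := fun h0 => by simpa [act, h0] using h'.1 i
  rw [act, act, hσ, smul_eq_mul, smul_eq_mul] at hi
  exact Units.ext (Int.cast_injective (mul_right_cancel₀ hne hi))

theorem InChamber.of_forall_pos_iff {g : SignedPerm n} {γ γ' : Fin n → ℝ} (h : InChamber g γ)
    (H : ∀ p ∈ rootIndex n, (0 < rootForm p γ ↔ 0 < rootForm p γ')) : InChamber g γ' := by
  have hlt : ∀ a b : Letter n, letter a γ < letter b γ → letter a γ' < letter b γ' := by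
    intro a b hab
    have hne : b ≠ a := by rintro rfl; exact lt_irrefl _ hab
    exact rootForm_pos_iff.1 ((H (b, a) hne).1 (rootForm_pos_iff.2 hab))
  exact ⟨fun i => hlt none (some (g.1 i, g.2 i)) (h.1 i),
    fun i j hij => hlt (some (g.1 j, g.2 j)) (some (g.1 i, g.2 i)) (h.2 hij)⟩

/-- The regions of a subspace are the chambers which it meets. -/
theorem ncard_chambers_eq_regionCount (U : Submodule ℝ (Fin n → ℝ)) :
    {g : SignedPerm n | ∃ γ ∈ U, InChamber g γ}.ncard =
      regionCount rootForm (rootIndex n) U := by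
  have hex : ∀ γ : Fin n → ℝ, ∃ g : SignedPerm n,
      γ ∈ regular rootForm (rootIndex n) → InChamber g γ := by
    intro γ
    by_cases hγ : γ ∈ regular rootForm (rootIndex n)
    · obtain ⟨g, hg⟩ := exists_inChamber hγ
      exact ⟨g, fun _ => hg⟩
    · exact ⟨1, fun h => absurd h hγ⟩
  choose h hh using hex
  have himg : {g : SignedPerm n | ∃ γ ∈ U, InChamber g γ} =
      h '' (U ∩ regular rootForm (rootIndex n)) := by
    ext g
    constructor
    · rintro ⟨γ, hγ, hg⟩
      exact ⟨γ, ⟨hγ, hg.mem_regular⟩, (hh γ hg.mem_regular).unique hg⟩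
    · rintro ⟨γ, ⟨hγ, hr⟩, rfl⟩
      exact ⟨γ, hγ, hh γ hr⟩
  rw [himg, regionCount]
  refine ncard_image_eq_ncard_image ?_
  rintro γ ⟨-, hγ⟩ γ' ⟨-, hγ'⟩
  rw [positivePart_eq_iff]
  constructor
  · intro heq p _
    have h1 := hh γ hγ
    have h2 := hh γ' hγ'
    rw [← heq] at h2
    rw [rootForm_pos_iff, rootForm_pos_iff]
    exact ⟨h1.letter_lt h2, h2.letter_lt h1⟩
  · intro H
    exact ((hh γ hγ).of_forall_pos_iff H).unique (hh γ' hγ')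

/-- Substitute `β = act g γ`: acting on coefficients and vectors alike only reorders the sum, since
the signs square to `1`. -/
theorem exists_mem_relations_inChamber_iff {V : Type*} [AddCommGroup V] [Module ℝ V]
    {x : Fin n → V} {g : SignedPerm n} :
    (∃ γ ∈ relations x, InChamber g γ) ↔
      ∃ β : Fin n → ℝ, (∀ i, 0 < β i) ∧ StrictAnti β ∧ ∑ i, β i • act g x i = 0 := by
  have hsum : ∀ γ : Fin n → ℝ, ∑ i, act g γ i • act g x i = ∑ j, γ j • x j := by
    intro γ
    rw [← Equiv.sum_comp g.1 fun j => γ j • x j]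
    refine Finset.sum_congr rfl fun i _ => ?_
    rw [act, act, smul_smul, smul_eq_mul, mul_right_comm, unit_mul_self, one_mul]
  constructor
  · rintro ⟨γ, hγ, hg⟩
    exact ⟨act g γ, hg.1, hg.2, (hsum γ).trans (mem_relations.1 hγ)⟩
  · rintro ⟨β, hβ, hβ', h0⟩
    have hact : act g (fun j => ((g.2 (g.1.symm j) : ℤ) : ℝ) * β (g.1.symm j)) = β := by
      ext i
      simp [act, ← mul_assoc, unit_mul_self]
    refine ⟨fun j => ((g.2 (g.1.symm j) : ℤ) : ℝ) * β (g.1.symm j), mem_relations.2 ?_, ?_, ?_⟩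
    · rw [← hsum, hact, h0]
    · rwa [hact]
    · rwa [hact]

end Chamber

/-! ### General position of partial sums implies genericity -/

section GeneralPosition

variable {V : Type*} [AddCommGroup V] [Module ℝ V] {n d : ℕ}

/-- If any `d` partial sums are independent after any signed permutation of the vectors, then
signed sums over `d` disjoint blocks span: they are differences of partial sums after a signed
permutation which moves the blocks to the front, one after another. -/
theorem generic_of_linearIndependent_psum [FiniteDimensional ℝ V] {x : Fin n → V}
    (hV : Module.finrank ℝ V = d)
    (hx : ∀ (g : SignedPerm n) (k : Fin d → Fin n), StrictMono k →
      LinearIndependent ℝ fun j => psum (act g x) (k j)) : Generic d x := by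
  classical
  intro w hw hw0 hdisj
  -- The number of the block containing `i`; the default `d` sorts unused indices to the end.
  set c : Fin n → ℕ := fun i => if h : ∃ j, w j i ≠ 0 then (h.choose : ℕ) else d with hc
  have hcw : ∀ {i j}, w j i ≠ 0 → c i = j := by
    intro i j h
    have hex : ∃ j, w j i ≠ 0 := ⟨j, h⟩
    simp only [hc, hex, dif_pos]
    exact congrArg Fin.val (hdisj i _ _ hex.choose_spec h)
  have hwc : ∀ {i} {j : Fin d}, c i = j → w j i ≠ 0 := by
    intro i j h
    by_cases hex : ∃ j, w j i ≠ 0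
    · simp only [hc, hex, dif_pos] at h
      rw [← Fin.ext h]
      exact hex.choose_spec
    · simp only [hc, hex, dif_neg, not_false_iff] at h
      exact absurd h j.2.ne'
  set σ := Tuple.sort c with hσ
  have hmono : Monotone (c ∘ σ) := Tuple.monotone_sort c
  set ε : Fin n → ℤˣ := fun i => if ∃ j, w j (σ i) = -1 then -1 else 1 with hε
  have hwε : ∀ i j, w j (σ i) ≠ 0 → w j (σ i) = ((ε i : ℤ) : ℝ) := by
    intro i j h
    rcases hw j (σ i) with h0 | h1 | h1
    · exact absurd h0 h
    · have : ¬ ∃ j, w j (σ i) = -1 := by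
        rintro ⟨j', hj'⟩
        have := hdisj (σ i) j j' h (by rw [hj']; norm_num)
        rw [← this, h1] at hj'
        norm_num at hj'
      simp [hε, this, h1]
    · have : ∃ j, w j (σ i) = -1 := ⟨j, h1⟩
      simp [hε, this, h1]
  have hne : ∀ j : Fin d, (Finset.univ.filter fun i => c (σ i) = j).Nonempty := by
    intro j
    obtain ⟨i, hi⟩ := Function.ne_iff.1 (hw0 j)
    exact ⟨σ.symm i, by simpa using hcw hi⟩
  -- The last position of block `j` after sorting, so the partial sum up to it consists of the
  -- blocks `0, …, j`.
  set k : Fin d → Fin n := fun j => (Finset.univ.filter fun i => c (σ i) = j).max' (hne j) with hk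
  have hck : ∀ j, c (σ (k j)) = j := fun j =>
    (Finset.mem_filter.1 (Finset.max'_mem _ (hne j))).2
  have hkmax : ∀ {i j}, c (σ i) = (j : Fin d) → i ≤ k j := fun {i j} h =>
    Finset.le_max' _ _ (Finset.mem_filter.2 ⟨Finset.mem_univ i, h⟩)
  have hkmono : StrictMono k := by
    intro j j' hjj'
    by_contra hle
    have := hmono (not_lt.1 hle)
    simp only [Function.comp_apply, hck] at this
    exact absurd hjj' (not_lt.2 (Fin.le_def.2 this))
  have hkey : ∀ j i, ∑ j' ∈ Finset.Iic j, w j' (σ i) =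
      if i ≤ k j then ((ε i : ℤ) : ℝ) else 0 := by
    intro j i
    split_ifs with hi
    · have hci : c (σ i) ≤ j := hck j ▸ hmono hi
      have hcj : c (σ i) = (⟨c (σ i), hci.trans_lt j.2⟩ : Fin d) := rfl
      rw [Finset.sum_eq_single_of_mem (⟨c (σ i), hci.trans_lt j.2⟩ : Fin d)
        (Finset.mem_Iic.2 (Fin.le_def.2 hci))]
      · exact hwε _ _ (hwc hcj)
      · intro j' _ hj'
        by_contra h
        exact hj' (Fin.ext (hcw h).symm)
    · refine Finset.sum_eq_zero fun j' hj' => ?_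
      by_contra h
      have h1 := hcw h
      have h2 : (j : ℕ) ≤ c (σ i) := hck j ▸ hmono (not_le.1 hi).le
      have h3 : (j' : ℕ) ≤ j := Fin.le_def.1 (Finset.mem_Iic.1 hj')
      exact hi (hkmax (h1.trans (le_antisymm h3 (h1 ▸ h2))))
  have hpsum : ∀ j, psum (act (σ, ε) x) (k j) = ∑ j' ∈ Finset.Iic j, ∑ i, w j' i • x i := by
    intro j
    rw [Finset.sum_comm, ← Equiv.sum_comp σ, psum]
    simp only [← Finset.sum_smul, hkey, ite_smul, zero_smul]
    rw [← Finset.sum_filter]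
    refine Finset.sum_congr ?_ fun i _ => rfl
    ext i
    simp
  have htop := (hx (σ, ε) k hkmono).span_eq_top_of_card_eq_finrank' (by simp [hV])
  rw [eq_top_iff, ← htop, Submodule.span_le]
  rintro _ ⟨j, rfl⟩
  change psum (act (σ, ε) x) (k j) ∈ _
  rw [hpsum]
  exact Submodule.sum_mem _ fun j' _ => Submodule.subset_span ⟨j', rfl⟩

theorem linearIndepOn_of_strictMono {s : Fin n → V}
    (hs : ∀ k : Fin d → Fin n, StrictMono k → LinearIndependent ℝ fun j => s (k j))
    {J : Finset (Fin n)} (hJ : J.card = d) : LinearIndepOn ℝ s (J : Set (Fin n)) := by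
  have h := hs (J.orderEmbOfFin hJ) (J.orderEmbOfFin hJ).strictMono
  exact (linearIndependent_equiv' (J.orderIsoOfFin hJ).toEquiv rfl).1 h

/-- The number of signed permutations after which the convex hull of the partial sums contains the
origin is the same for all vectors in general position. -/
theorem ncard_zero_mem_convexHull [FiniteDimensional ℝ V] {x : Fin n → V}
    (hV : Module.finrank ℝ V = d) (hd : d ≤ n)
    (hx : ∀ (g : SignedPerm n) (k : Fin d → Fin n), StrictMono k →
      LinearIndependent ℝ fun j => psum (act g x) (k j)) :
    {g : SignedPerm n | (0 : V) ∈ convexHull ℝ (Set.range (psum (act g x)))}.ncard =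
      2 * altSum n (d + 1) := by
  cases n with
  | zero =>
    -- Here the chamber count would be `1`, but the hull of no points is empty.
    rw [altSum_eq_zero (Nat.succ_pos d)]
    simp
  | succ n =>
    rw [← (generic_of_linearIndependent_psum hV hx).regionCount_eq n inferInstance hd hV,
      ← ncard_chambers_eq_regionCount]
    congr 1
    ext g
    have := zero_mem_convexHull_psum_iff (x := act g x) hV hd
      fun J hJ => linearIndepOn_of_strictMono (hx g) hJ
    rw [Set.mem_ofPred_eq, Set.mem_ofPred_eq, this, exists_mem_relations_inChamber_iff]
    simp

end GeneralPosition

/-! ### Averaging over signed permutations -/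

section Probability

variable {Ω : Type*} [MeasurableSpace Ω] {μ : Measure Ω} {d n : ℕ} {ξ : Fin n → Ω → E d}

/-- The set is the projection of a closed set along the compact simplex of weights, hence closed. -/
theorem measurableSet_zero_mem_convexHull :
    MeasurableSet {x : Fin n → E d | (0 : E d) ∈ convexHull ℝ (Set.range (psum x))} := by
  have hcl : IsClosed {p : stdSimplex ℝ (Fin n) × (Fin n → E d) |
      ∑ k, (p.1 : Fin n → ℝ) k • psum p.2 k = 0} := by
    refine isClosed_eq ?_ continuous_const
    refine continuous_finsetSum _ fun k _ => Continuous.smul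
      ((continuous_apply k).comp (continuous_subtype_val.comp continuous_fst)) ?_
    unfold psum
    fun_prop
  have : CompactSpace (stdSimplex ℝ (Fin n)) :=
    isCompact_iff_compactSpace.1 (isCompact_stdSimplex (𝕜 := ℝ) (Fin n))
  have := isClosedMap_snd_of_compactSpace _ hcl
  convert this.measurableSet using 1
  ext x
  rw [Set.mem_ofPred_eq, zero_mem_convexHull_range_iff]
  constructor
  · rintro ⟨c, hc, h⟩
    exact ⟨(⟨c, hc⟩, x), h, rfl⟩
  · rintro ⟨⟨c, y⟩, h, rfl⟩
    exact ⟨c, c.2, h⟩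

theorem measurableSet_linearIndependent_psum {m : ℕ} (k : Fin m → Fin n) :
    MeasurableSet {x : Fin n → E d | LinearIndependent ℝ fun j => psum x (k j)} := by
  have hc : Continuous fun (x : Fin n → E d) (j : Fin m) => psum x (k j) := by
    unfold psum
    fun_prop
  exact (isOpen_setOfPred_linearIndependent.preimage hc).measurableSet

theorem SymmetricallyExchangeable.identDistrib_act (h : SymmetricallyExchangeable μ ξ)
    (g : SignedPerm n) :
    IdentDistrib (fun ω i => ξ i ω) (fun ω => act g fun i => ξ i ω) μ μ :=
  h g.1 (fun i => ((g.2 i : ℤ) : ℝ)) fun i => by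
    rcases Int.units_eq_one_or (g.2 i) with h | h <;> simp [h]

theorem ae_linearIndependent_psum_act (hse : SymmetricallyExchangeable μ ξ)
    (hgp : PartialSumsInGeneralPosition μ ξ) :
    ∀ᵐ ω ∂μ, ∀ (g : SignedPerm n) (k : Fin d → Fin n), StrictMono k →
      LinearIndependent ℝ fun j => psum (act g fun i => ξ i ω) (k j) := by
  rw [ae_all_iff]
  intro g
  rw [ae_all_iff]
  intro k
  by_cases hk : StrictMono k
  · have h := (hse.identDistrib_act g).ae_snd
      (p := fun x => LinearIndependent ℝ fun j => psum x (k j))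
      (measurableSet_linearIndependent_psum k) (hgp k hk)
    filter_upwards [h] with ω hω _ using hω
  · exact Filter.Eventually.of_forall fun ω h => absurd h hk

theorem card_signedPerm (n : ℕ) : Fintype.card (SignedPerm n) = 2 ^ n * n.factorial := by
  rw [Fintype.card_prod, Fintype.card_perm, Fintype.card_fun]
  simp [mul_comm]

/-- The absorption probability, for symmetrically exchangeable increments. -/
theorem measureReal_zero_mem_hull [IsProbabilityMeasure μ] (hξ : ∀ i, Measurable (ξ i))
    (hse : SymmetricallyExchangeable μ ξ) (hd : d ≤ n) (hgp : PartialSumsInGeneralPosition μ ξ) :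
    μ.real {ω | (0 : E d) ∈ hull ξ ω} =
      2 / (2 ^ n * (n.factorial : ℝ)) * (altSum n (d + 1) : ℝ) := by
  classical
  set A : Set (Fin n → E d) := {x | (0 : E d) ∈ convexHull ℝ (Set.range (psum x))} with hA
  have hAm : MeasurableSet A := measurableSet_zero_mem_convexHull
  set X : Ω → Fin n → E d := fun ω i => ξ i ω with hX
  have hXm : Measurable X := measurable_pi_lambda _ hξ
  have hactm : ∀ g : SignedPerm n, Measurable fun x : Fin n → E d => act g x := by
    intro g
    unfold act
    fun_prop
  have hSm : ∀ g : SignedPerm n, MeasurableSet {ω | act g (X ω) ∈ A} := fun g =>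
    ((hactm g).comp hXm) hAm
  have hprob : ∀ g : SignedPerm n, μ.real {ω | act g (X ω) ∈ A} = μ.real {ω | X ω ∈ A} := by
    intro g
    have := (hse.identDistrib_act g).measure_mem_eq hAm
    exact congrArg ENNReal.toReal this.symm
  have hint : ∀ g : SignedPerm n,
      ∫ ω, {ω | act g (X ω) ∈ A}.indicator (fun _ => (1 : ℝ)) ω ∂μ = μ.real {ω | X ω ∈ A} := by
    intro g
    rw [integral_indicator_const _ (hSm g), hprob g, smul_eq_mul, mul_one]
  have hsum : ∑ g : SignedPerm n,
      ∫ ω, {ω | act g (X ω) ∈ A}.indicator (fun _ => (1 : ℝ)) ω ∂μ = 2 * altSum n (d + 1) := by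
    rw [← integral_finsetSum _ fun g _ => (integrable_const (1 : ℝ)).indicator (hSm g)]
    -- Almost surely the number of favourable signed permutations is the deterministic count.
    have hae : (fun ω => ∑ g : SignedPerm n, {ω | act g (X ω) ∈ A}.indicator (fun _ => (1 : ℝ)) ω)
        =ᵐ[μ] fun _ => 2 * (altSum n (d + 1) : ℝ) := by
      filter_upwards [ae_linearIndependent_psum_act hse hgp] with ω hω
      have hcount := ncard_zero_mem_convexHull (d := d) (by simp) hd hω
      rw [Set.ncard_eq_toFinset_card'] at hcount
      have hcast := congrArg (Nat.cast : ℕ → ℝ) hcount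
      push_cast at hcast
      rw [← hcast]
      simp only [Set.indicator_apply, Set.mem_ofPred_eq]
      rw [Finset.sum_boole]
      congr 2
      ext g
      simp [hA, hX]
    rw [integral_congr_ae hae]
    simp
  simp only [hint, Finset.sum_const, Finset.card_univ, card_signedPerm, nsmul_eq_mul] at hsum
  push_cast at hsum
  have hpos : (0 : ℝ) < 2 ^ n * (n.factorial : ℝ) := by positivity
  have hgoal : μ.real {ω | X ω ∈ A} = 2 / (2 ^ n * (n.factorial : ℝ)) * (altSum n (d + 1) : ℝ) := by
    field_simp
    linarith
  exact hgoal

end Probability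

/-! ### Independent increments and the complementary formula -/

section Independent

variable {Ω : Type*} [MeasurableSpace Ω] {μ : Measure Ω} {d n : ℕ} {ξ : Fin n → Ω → E d}

theorem symmetricallyExchangeable_of_iIndepFun [IsProbabilityMeasure μ]
    (hξ : ∀ i, Measurable (ξ i)) (hind : iIndepFun ξ μ)
    (hid : ∀ i j, IdentDistrib (ξ i) (ξ j) μ μ)
    (hsymm : ∀ i, IdentDistrib (ξ i) (fun ω => -ξ i ω) μ μ) : SymmetricallyExchangeable μ ξ := by
  intro σ ε hε
  have hm : ∀ i, Measurable fun ω => ε i • ξ (σ i) ω := fun i => (hξ (σ i)).const_smul (ε i)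
  have hmarg : ∀ i, IdentDistrib (ξ i) (fun ω => ε i • ξ (σ i) ω) μ μ := by
    intro i
    rcases hε i with h | h
    · simpa [h] using hid i (σ i)
    · simpa [h] using (hid i (σ i)).trans (hsymm (σ i))
  have hind' : iIndepFun (fun i ω => ε i • ξ (σ i) ω) μ :=
    (hind.precomp σ.injective).comp (fun i v => ε i • v) fun i => measurable_const_smul (ε i)
  refine ⟨(measurable_pi_lambda _ hξ).aemeasurable, (measurable_pi_lambda _ hm).aemeasurable, ?_⟩
  rw [hind.map_fun_eq_pi_map fun i => (hξ i).aemeasurable,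
    hind'.map_fun_eq_pi_map fun i => (hm i).aemeasurable]
  congr 1
  ext1 i
  exact (hmarg i).map_eq

/-- One of the independent vectors is independent of the tuple of the others. -/
theorem indepFun_update_zero (hξ : ∀ i, Measurable (ξ i)) (hind : iIndepFun ξ μ) (a : Fin n) :
    IndepFun (fun ω => Function.update (fun i => ξ i ω) a 0) (ξ a) μ := by
  have h := hind.indepFun_finset (Finset.univ.erase a) {a} (by simp) hξ
  have hψ : Measurable fun (y : ↥(Finset.univ.erase a : Finset (Fin n)) → E d) (i : Fin n) =>
      if h : i ∈ Finset.univ.erase a then y ⟨i, h⟩ else (0 : E d) := by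
    refine measurable_pi_lambda _ fun i => ?_
    by_cases h : i ∈ Finset.univ.erase a
    · simpa only [h, dif_pos] using measurable_pi_apply _
    · simpa only [h, dif_neg, not_false_iff] using measurable_const
  have hφ : Measurable fun y : ({a} : Finset (Fin n)) → E d => y ⟨a, Finset.mem_singleton_self a⟩ :=
    measurable_pi_apply _
  convert h.comp hψ hφ using 1
  · ext ω i : 2
    by_cases hi : i = a
    · subst hi; simp
    · simp [hi]
  · rfl

theorem measure_add_mem_eq_zero {ν : Measure (E d)}
    (hν : ∀ H : Set (E d), IsAffineHyperplane H → ν H = 0) (c : E d) {U : Submodule ℝ (E d)}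
    (hU : U ≠ ⊤) : ν {z | z + c ∈ U} = 0 := by
  have hbot : Uᗮ ≠ ⊥ := fun h => hU (U.orthogonal_eq_bot_iff.1 h)
  obtain ⟨v, hv, hv0⟩ := Submodule.exists_mem_ne_zero_of_ne_bot hbot
  refine measure_mono_null ?_ (hν {z | inner ℝ v z = -inner ℝ v c} ⟨v, hv0, _, rfl⟩)
  intro z hz
  have := (Submodule.mem_orthogonal' U v).1 hv _ hz
  rw [inner_add_right] at this
  exact eq_neg_of_add_eq_zero_left this

theorem psum_update_of_lt {V : Type*} [AddCommGroup V] (x : Fin n → V) {a k : Fin n} (h : k < a)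
    (z : V) : psum (Function.update x a z) k = psum x k := by
  refine Finset.sum_congr rfl fun i hi => Function.update_of_ne ?_ _ _
  rintro rfl
  exact absurd (Finset.mem_Iic.1 hi) (not_le.2 h)

theorem psum_update_self {V : Type*} [AddCommGroup V] (x : Fin n → V) (a : Fin n) (z : V) :
    psum (Function.update x a z) a = z + ∑ i ∈ (Finset.Iic a).erase a, x i := by
  rw [psum, ← Finset.add_sum_erase _ _ (Finset.mem_Iic.2 le_rfl), Function.update_self]
  congr 1
  exact Finset.sum_congr rfl fun i hi => Function.update_of_ne (Finset.ne_of_mem_erase hi) _ _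

/-- Induction on the number of sums: the last one contains an increment absent from the earlier
ones. Given all other increments, dependence would force it into a translate of a proper subspace,
which has measure zero. -/
theorem ae_linearIndependent_psum [IsProbabilityMeasure μ] (hξ : ∀ i, Measurable (ξ i))
    (hind : iIndepFun ξ μ)
    (hH : ∀ i, ∀ H : Set (E d), IsAffineHyperplane H → μ {ω | ξ i ω ∈ H} = 0) {m : ℕ} (hm : m ≤ d)
    {k : Fin m → Fin n} (hk : StrictMono k) :
    ∀ᵐ ω ∂μ, LinearIndependent ℝ fun j => psum (fun i => ξ i ω) (k j) := by
  induction m with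
  | zero => exact Filter.Eventually.of_forall fun ω => linearIndependent_empty_type
  | succ m ih =>
    have ih := ih (by omega) (k := k ∘ Fin.castSucc) (hk.comp Fin.strictMono_castSucc)
    set a := k (Fin.last m) with ha
    set Y : Ω → Fin n → E d := fun ω => Function.update (fun i => ξ i ω) a 0 with hY
    have hYm : Measurable Y :=
      measurable_update_left.comp (measurable_pi_lambda _ hξ)
    set bad : Set ((Fin n → E d) × E d) := {p |
      (LinearIndependent ℝ fun j => psum (Function.update p.1 a p.2) ((k ∘ Fin.castSucc) j)) ∧
      ¬ LinearIndependent ℝ fun j => psum (Function.update p.1 a p.2) (k j)} with hbad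
    have hupd : Measurable fun p : (Fin n → E d) × E d => Function.update p.1 a p.2 :=
      measurable_update'
    have hbadm : MeasurableSet bad :=
      (hupd (measurableSet_linearIndependent_psum (k ∘ Fin.castSucc))).inter
        (hupd (measurableSet_linearIndependent_psum k)).compl
    have hν : ∀ H : Set (E d), IsAffineHyperplane H → μ.map (ξ a) H = 0 := by
      intro H hHyp
      have hHm : MeasurableSet H := by
        obtain ⟨v, -, c, rfl⟩ := hHyp
        exact (isClosed_eq (by fun_prop) continuous_const).measurableSet
      rw [Measure.map_apply (hξ a) hHm]
      exact hH a H hHyp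
    have hnull : ((μ.map Y).prod (μ.map (ξ a))) bad = 0 := by
      rw [Measure.measure_prod_null hbadm]
      refine Filter.Eventually.of_forall fun x => ?_
      have hlt : ∀ j : Fin m, k j.castSucc < a := fun j => hk (Fin.castSucc_lt_last j)
      set U : Submodule ℝ (E d) := Submodule.span ℝ (Set.range fun j : Fin m => psum x (k j.castSucc))
      have hU : U ≠ ⊤ := by
        intro h
        have h1 : Module.finrank ℝ U ≤ Fintype.card (Fin m) :=
          finrank_range_le_card (R := ℝ) fun j : Fin m => psum x (k j.castSucc)
        rw [h, finrank_top, finrank_euclideanSpace, Fintype.card_fin, Fintype.card_fin] at h1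
        omega
      refine measure_mono_null ?_
        (measure_add_mem_eq_zero hν (∑ i ∈ (Finset.Iic a).erase a, x i) hU)
      rintro z ⟨h1, h2⟩
      by_contra hz
      refine h2 (linearIndependent_finSucc'.2 ⟨h1, ?_⟩)
      intro hmem
      apply hz
      rw [← ha, psum_update_self] at hmem
      have hinit : (Fin.init fun j => psum (Function.update x a z) (k j)) =
          fun j : Fin m => psum x (k j.castSucc) :=
        funext fun j => psum_update_of_lt x (hlt j) z
      rw [hinit] at hmem
      exact hmem
    have hprod := (indepFun_iff_map_prod_eq_prod_map_map hYm.aemeasurable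
      (hξ a).aemeasurable).1 (indepFun_update_zero hξ hind a)
    rw [← hprod, Measure.map_apply (hYm.prodMk (hξ a)) hbadm] at hnull
    have hae : ∀ᵐ ω ∂μ, (Y ω, ξ a ω) ∉ bad := measure_eq_zero_iff_ae_notMem.1 hnull
    filter_upwards [ih, hae] with ω h1 h2
    have hx : Function.update (Y ω) a (ξ a ω) = fun i => ξ i ω := by
      simp [hY]
    by_contra h3
    refine h2 ⟨?_, ?_⟩
    · simpa only [hx] using h1
    · simpa only [hx] using h3

theorem zero_notMem_convexHull_of_linearIndependent {V : Type*} [AddCommGroup V] [Module ℝ V]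
    {s : Fin n → V} (hs : LinearIndependent ℝ s) : (0 : V) ∉ convexHull ℝ (Set.range s) := by
  rw [zero_mem_convexHull_range_iff]
  rintro ⟨c, hc, h0⟩
  have hz := Fintype.linearIndependent_iff.1 hs c h0
  have := hc.2
  simp [hz] at this

theorem nat_ceil_half (d : ℕ) : ⌈(d : ℝ) / 2⌉₊ = (d + 1) / 2 := by
  apply le_antisymm
  · rw [Nat.ceil_le, div_le_iff₀ two_pos]
    exact_mod_cast (by omega : d ≤ (d + 1) / 2 * 2)
  · have h := Nat.le_ceil ((d : ℝ) / 2)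
    rw [div_le_iff₀ two_pos] at h
    have h' : d ≤ ⌈(d : ℝ) / 2⌉₊ * 2 := by exact_mod_cast h
    omega

/-- The coefficients of one parity class sum to half of the value at `1`. -/
theorem sum_B_add_altSum (n : ℕ) : ∀ d : ℕ,
    2 * (∑ k ∈ Finset.Icc 1 ((d + 1) / 2), B (n + 1) (d + 1 - 2 * k) + altSum (n + 1) (d + 1)) =
      2 ^ (n + 1) * (n + 1).factorial
  | 0 => by simpa using two_mul_altSum_one n
  | 1 => by
    rw [← two_mul_altSum_one, altSum_one_eq_altSum_zero, altSum_eq_add (n + 1) 0]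
    simp
  -- Passing from `d` to `d + 2` moves `B (n + 1) (d + 1)` from the upper sum to the lower one.
  | d + 2 => by
    rw [← sum_B_add_altSum n d, altSum_eq_add (n + 1) (d + 1)]
    have hIcc : ∀ m, Finset.Icc 1 m = Finset.Ico 1 (m + 1) := fun m => by ext; simp
    rw [show (d + 2 + 1) / 2 = (d + 1) / 2 + 1 by omega, hIcc, hIcc, Finset.sum_Ico_eq_sum_range,
      Finset.sum_Ico_eq_sum_range, Nat.add_sub_cancel, Nat.add_sub_cancel, Finset.sum_range_succ']
    have hshift : ∀ j, d + 2 + 1 - 2 * (1 + (j + 1)) = d + 1 - 2 * (1 + j) := fun j => by omega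
    simp only [hshift]
    rw [show d + 2 + 1 - 2 * (1 + 0) = d + 1 by omega, show d + 2 + 1 = d + 1 + 2 by omega]
    ring

/-- The non-absorption probability, for symmetric i.i.d. increments. -/
theorem measureReal_zero_notMem_hull [IsProbabilityMeasure μ] (hξ : ∀ i, Measurable (ξ i))
    (hn : 1 ≤ n) (hind : iIndepFun ξ μ) (hid : ∀ i j, IdentDistrib (ξ i) (ξ j) μ μ)
    (hsymm : ∀ i, IdentDistrib (ξ i) (fun ω => -ξ i ω) μ μ)
    (hH : ∀ i, ∀ H : Set (E d), IsAffineHyperplane H → μ {ω | ξ i ω ∈ H} = 0) :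
    μ.real {ω | (0 : E d) ∉ hull ξ ω} = 2 / (2 ^ n * (n.factorial : ℝ)) *
      ∑ k ∈ Finset.Icc 1 ⌈(d : ℝ) / 2⌉₊, (B n (d + 1 - 2 * k) : ℝ) := by
  obtain ⟨n, rfl⟩ := Nat.exists_eq_add_of_le' hn
  have hpos : (0 : ℝ) < 2 ^ (n + 1) * ((n + 1).factorial : ℝ) := by positivity
  have hsum := congrArg (Nat.cast : ℕ → ℝ) (sum_B_add_altSum n d)
  push_cast at hsum
  rw [nat_ceil_half]
  have hmem : μ.real {ω | (0 : E d) ∈ hull ξ ω} =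
      2 / (2 ^ (n + 1) * ((n + 1).factorial : ℝ)) * (altSum (n + 1) (d + 1) : ℝ) := by
    rcases le_or_gt d (n + 1) with hd | hd
    · exact measureReal_zero_mem_hull hξ (symmetricallyExchangeable_of_iIndepFun hξ hind hid hsymm)
        hd fun k hk => ae_linearIndependent_psum hξ hind hH le_rfl hk
    -- For `d > n + 1` part (a) does not apply, but all the partial sums are almost surely
    -- independent, which keeps `0` out of the hull.
    · rw [altSum_eq_zero (by omega), Nat.cast_zero, mul_zero, measureReal_def]
      have hae : ∀ᵐ ω ∂μ, (0 : E d) ∉ hull ξ ω := by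
        filter_upwards [ae_linearIndependent_psum hξ hind hH hd.le (k := id) strictMono_id]
          with ω hω using zero_notMem_convexHull_of_linearIndependent hω
      have : μ {ω | (0 : E d) ∈ hull ξ ω} = 0 := by simpa [ae_iff] using hae
      rw [this, ENNReal.toReal_zero]
  have hm : MeasurableSet {ω | (0 : E d) ∈ hull ξ ω} :=
    (measurable_pi_lambda (fun ω i => ξ i ω) hξ) measurableSet_zero_mem_convexHull
  have hcompl := probReal_compl_eq_one_sub (μ := μ) hm
  have hgoal : μ.real {ω | (0 : E d) ∈ hull ξ ω}ᶜ = 2 / (2 ^ (n + 1) * ((n + 1).factorial : ℝ)) *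
      ∑ k ∈ Finset.Icc 1 ((d + 1) / 2), (B (n + 1) (d + 1 - 2 * k) : ℝ) := by
    rw [hcompl, hmem, sub_eq_iff_eq_add, ← mul_add, div_mul_eq_mul_div, hsum, div_self hpos.ne']
  exact hgoal

end Independent

end RandomWalkHull

/-- The first part is the absorption formula for symmetrically exchangeable increments. The sum
`B(n, d + 1) + B(n, d + 3) + ⋯` is written with `n + 1` terms; all further terms vanish, since
their second index exceeds `n`.
The second part is the non-absorption formula for i.i.d. increments; there `d + 1 - 2 * k` is never
truncated, since `2 * k ≤ d + 1`. -/
theorem theorem2p3 {Ω : Type*} [MeasurableSpace Ω] (μ : Measure Ω) [IsProbabilityMeasure μ]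
    (d n : ℕ) (ξ : Fin n → Ω → RandomWalkHull.E d) (hξ : ∀ i, Measurable (ξ i)) :
    (RandomWalkHull.SymmetricallyExchangeable μ ξ → d ≤ n →
      RandomWalkHull.PartialSumsInGeneralPosition μ ξ →
      μ.real {ω | (0 : RandomWalkHull.E d) ∈ RandomWalkHull.hull ξ ω} =
        2 / (2 ^ n * (n.factorial : ℝ)) *
          ∑ j ∈ Finset.range (n + 1), (RandomWalkHull.B n (d + 1 + 2 * j) : ℝ)) ∧
    (1 ≤ n → iIndepFun ξ μ → (∀ i j, IdentDistrib (ξ i) (ξ j) μ μ) →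
      (∀ i, IdentDistrib (ξ i) (fun ω => -ξ i ω) μ μ) →
      (∀ i, ∀ H : Set (RandomWalkHull.E d), RandomWalkHull.IsAffineHyperplane H →
        μ {ω | ξ i ω ∈ H} = 0) →
      μ.real {ω | (0 : RandomWalkHull.E d) ∉ RandomWalkHull.hull ξ ω} =
        2 / (2 ^ n * (n.factorial : ℝ)) *
          ∑ k ∈ Finset.Icc 1 ⌈(d : ℝ) / 2⌉₊, (RandomWalkHull.B n (d + 1 - 2 * k) : ℝ)) := by
  refine ⟨fun hse hd hgp => ?_, fun hn hind hid hsymm hH =>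
    RandomWalkHull.measureReal_zero_notMem_hull hξ hn hind hid hsymm hH⟩
  rw [RandomWalkHull.measureReal_zero_mem_hull hξ hse hd hgp, RandomWalkHull.altSum, Nat.cast_sum]
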